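/- Let $d \ge 0$ be an integer and let $V_d$ be the space of complex binary forms of degree $d$ with the natural action of $SL_2(\mathbb{C})$. Let $\mathcal{I}_{d,d} = \mathcal{O}(V_d \oplus V_d)^{SL_2}$ and $\mathcal{C}_{d,d} = \mathcal{O}(V_d \oplus V_d \oplus \mathbb{C}^2)^{SL_2}$ be the algebras of joint invariants and of joint covariants of two binary forms of degree $d$, graded by the degree in the coefficients of the two forms. Let $\mathcal{S}_{d,d} = \{v \in S(V_d \oplus V_d) : D_1(v) = 0\}$ be the graded algebra of joint semi-invariants, where $D_1$ is the derivation with $D_1(v_i) = i\,v_{i-1}$ on the standard basis $v_0, \dots, v_d$ of each summand $V_d$. All homogeneous components of these algebras are finite-dimensional; let $$\mathcal{PI}_{d,d}(z) = \sum_{n \ge 0} \dim (\mathcal{I}_{d,d})_n z^n, \quad \mathcal{PC}_{d,d}(z) = \sum_{n \ge 0} \dim (\mathcal{C}_{d,d})_n z^n, \quad \mathcal{PS}_{d,d}(z) = \sum_{n \ge 0} \dim (\mathcal{S}_{d,d})_n z^n$$ be their Poincaré series. For an integer $n \ge 0$ define $\varphi_n : \mathbb{C}[[z]] \to \mathbb{C}[[z]]$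 by $\varphi_n\left(\sum_{i \ge 0} a_i z^i\right) = \sum_{i \ge 0} a_{in} z^i$, and put $$f_{d,d}(t,z) = \frac{1}{\prod_{i=0}^{d} (1 - t z^{d-2i})^2}.$$ Then for $0 \le k \le d/2$ and $0 < |z| < 1$ the limits $$A_k(z) = -\frac{1}{z^{2k}} \lim_{t \to z^{-2k}} \frac{\partial}{\partial t}\left( f_{d,d}(t z^d, z) (1 - t z^{2k})^2 \right), \qquad B_k(z) = \lim_{t \to z^{-2k}} f_{d,d}(t z^d, z) (1 - t z^{2k})^2$$ exist, $A_k$ and $B_k$ are given on $0 < |z| < 1$ by power series in $z$ (denoted by the same letters), and $$\mathcal{PI}_{d,d}(z) = \sum_{0 \le k \le d/2} \varphi_{d-2k}\left((1-z^2) A_k(z)\right) + \sum_{0 \le k \le d/2} \left(z\, \varphi_{d-2k}\left((1-z^2) B_k(z)\right)\right)',$$ $$\mathcal{PC}_{d,d}(z) = \mathcal{PS}_{d,d}(z) = \sum_{0 \le k \le d/2} \varphi_{d-2k}\left((1+z) A_k(z)\right) + \sum_{0 \le k \le d/2} \left(z\, \varphi_{d-2k}\left((1+z) B_k(z)\right)\right)'.$$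 -/

import Mathlib

open scoped PowerSeries Topology

/-- Index set of the coordinates on the space `V_{d₁} ⊕ V_{d₂}` of pairs of binary forms. -/
abbrev FormIdx (d₁ d₂ : ℕ) : Type := Fin (d₁ + 1) ⊕ Fin (d₂ + 1)

/-- The binary form `∑ aᵢ x^(d-i) y^i` of degree `d` with coefficient vector `a`. -/
noncomputable def binaryForm (d : ℕ) (a : Fin (d + 1) → ℂ) : MvPolynomial (Fin 2) ℂ :=
  ∑ i : Fin (d + 1), MvPolynomial.C (a i) *
    (MvPolynomial.X 0 ^ (d - (i : ℕ)) * MvPolynomial.X 1 ^ (i : ℕ))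

/-- The natural action of `SL₂` on forms, `(g • f)(v) = f(g⁻¹ v)`. -/
noncomputable def formAct (g : Matrix.SpecialLinearGroup (Fin 2) ℂ)
    (f : MvPolynomial (Fin 2) ℂ) : MvPolynomial (Fin 2) ℂ :=
  MvPolynomial.aeval
    (fun i => ∑ j : Fin 2,
      MvPolynomial.C ((g⁻¹).1 i j) * (MvPolynomial.X j : MvPolynomial (Fin 2) ℂ)) f

/-- The coefficient vector of `g • f`, where `f` is the form with coefficient vector `a`. -/
noncomputable def coeffAct (d : ℕ) (g : Matrix.SpecialLinearGroup (Fin 2) ℂ)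
    (a : Fin (d + 1) → ℂ) : Fin (d + 1) → ℂ :=
  fun i => MvPolynomial.coeff
    (Finsupp.single (0 : Fin 2) (d - (i : ℕ)) + Finsupp.single (1 : Fin 2) (i : ℕ))
    (formAct g (binaryForm d a))

/-- The algebra of joint invariants `𝒪(V_{d₁} ⊕ V_{d₂})^{SL₂}`. -/
noncomputable def jointInvariants (d₁ d₂ : ℕ) :
    Subalgebra ℂ (MvPolynomial (FormIdx d₁ d₂) ℂ) where
  carrier := {P | ∀ (g : Matrix.SpecialLinearGroup (Fin 2) ℂ)
    (a : Fin (d₁ + 1) → ℂ) (b : Fin (d₂ + 1) → ℂ),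
    MvPolynomial.eval (Sum.elim (coeffAct d₁ g a) (coeffAct d₂ g b)) P =
      MvPolynomial.eval (Sum.elim a b) P}
  mul_mem' := fun hP hQ g a b => by
    rw [map_mul, map_mul, hP g a b, hQ g a b]
  add_mem' := fun hP hQ g a b => by
    rw [map_add, map_add, hP g a b, hQ g a b]
  algebraMap_mem' := fun r g a b => by
    simp [MvPolynomial.algebraMap_eq]

/-- The algebra of joint covariants `𝒪(V_{d₁} ⊕ V_{d₂} ⊕ ℂ²)^{SL₂}`. -/
noncomputable def jointCovariants (d₁ d₂ : ℕ) :
    Subalgebra ℂ (MvPolynomial (FormIdx d₁ d₂ ⊕ Fin 2) ℂ) where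
  carrier := {P | ∀ (g : Matrix.SpecialLinearGroup (Fin 2) ℂ)
    (a : Fin (d₁ + 1) → ℂ) (b : Fin (d₂ + 1) → ℂ) (v : Fin 2 → ℂ),
    MvPolynomial.eval
        (Sum.elim (Sum.elim (coeffAct d₁ g a) (coeffAct d₂ g b)) (g.1.mulVec v)) P =
      MvPolynomial.eval (Sum.elim (Sum.elim a b) v) P}
  mul_mem' := fun hP hQ g a b v => by
    rw [map_mul, map_mul, hP g a b v, hQ g a b v]
  add_mem' := fun hP hQ g a b v => by
    rw [map_add, map_add, hP g a b v, hQ g a b v]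
  algebraMap_mem' := fun r g a b v => by
    simp [MvPolynomial.algebraMap_eq]

/-- The derivation `D₁` of `S(V_{d₁} ⊕ V_{d₂})`: `D₁(vᵢ) = i vᵢ₋₁` on the standard basis of either
summand (so `D₁(v₀) = 0`). -/
noncomputable def raisingDerivation (d₁ d₂ : ℕ) :
    Derivation ℂ (MvPolynomial (FormIdx d₁ d₂) ℂ) (MvPolynomial (FormIdx d₁ d₂) ℂ) :=
  MvPolynomial.mkDerivation ℂ (Sum.elim
    (fun i : Fin (d₁ + 1) => ((i : ℕ) : ℂ) •
      MvPolynomial.X (Sum.inl ⟨(i : ℕ) - 1, lt_of_le_of_lt (Nat.sub_le _ _) i.isLt⟩))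
    (fun i : Fin (d₂ + 1) => ((i : ℕ) : ℂ) •
      MvPolynomial.X (Sum.inr ⟨(i : ℕ) - 1, lt_of_le_of_lt (Nat.sub_le _ _) i.isLt⟩)))

/-- The algebra of joint semi-invariants `S(V_{d₁} ⊕ V_{d₂})^{𝔲₂} = ker D₁`. -/
noncomputable def jointSemiInvariants (d₁ d₂ : ℕ) :
    Subalgebra ℂ (MvPolynomial (FormIdx d₁ d₂) ℂ) where
  carrier := {P | raisingDerivation d₁ d₂ P = 0}
  mul_mem' := fun {P Q} (hP : _ = _) (hQ : _ = _) => by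
    change raisingDerivation d₁ d₂ (P * Q) = 0
    rw [Derivation.leibniz, hP, hQ, smul_zero, smul_zero, add_zero]
  add_mem' := fun {P Q} (hP : _ = _) (hQ : _ = _) => by
    change raisingDerivation d₁ d₂ (P + Q) = 0
    rw [map_add, hP, hQ, add_zero]
  algebraMap_mem' := fun r => Derivation.map_algebraMap _ r

/-- The joint invariants that are homogeneous of degree `n`. -/
noncomputable def invariantsOfDegree (d₁ d₂ n : ℕ) :
    Submodule ℂ (MvPolynomial (FormIdx d₁ d₂) ℂ) :=
  Subalgebra.toSubmodule (jointInvariants d₁ d₂) ⊓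
    MvPolynomial.homogeneousSubmodule (FormIdx d₁ d₂) ℂ n

/-- The joint semi-invariants that are homogeneous of degree `n`. -/
noncomputable def semiInvariantsOfDegree (d₁ d₂ n : ℕ) :
    Submodule ℂ (MvPolynomial (FormIdx d₁ d₂) ℂ) :=
  Subalgebra.toSubmodule (jointSemiInvariants d₁ d₂) ⊓
    MvPolynomial.homogeneousSubmodule (FormIdx d₁ d₂) ℂ n

/-- The joint covariants of degree `n`: the degree counts the coefficients of the two forms only,
the two coordinates on `ℂ²` have degree `0`. -/
noncomputable def covariantsOfDegree (d₁ d₂ n : ℕ) :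
    Submodule ℂ (MvPolynomial (FormIdx d₁ d₂ ⊕ Fin 2) ℂ) :=
  Subalgebra.toSubmodule (jointCovariants d₁ d₂) ⊓
    MvPolynomial.weightedHomogeneousSubmodule ℂ
      (Sum.elim (fun _ : FormIdx d₁ d₂ => 1) (fun _ : Fin 2 => 0) : FormIdx d₁ d₂ ⊕ Fin 2 → ℕ) n

/-- Poincaré series of the algebra of joint invariants. -/
noncomputable def poincareInvariants (d₁ d₂ : ℕ) : ℂ⟦X⟧ :=
  PowerSeries.mk fun n => (Module.finrank ℂ (invariantsOfDegree d₁ d₂ n) : ℂ)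

/-- Poincaré series of the algebra of joint semi-invariants. -/
noncomputable def poincareSemiInvariants (d₁ d₂ : ℕ) : ℂ⟦X⟧ :=
  PowerSeries.mk fun n => (Module.finrank ℂ (semiInvariantsOfDegree d₁ d₂ n) : ℂ)

/-- Poincaré series of the algebra of joint covariants. -/
noncomputable def poincareCovariants (d₁ d₂ : ℕ) : ℂ⟦X⟧ :=
  PowerSeries.mk fun n => (Module.finrank ℂ (covariantsOfDegree d₁ d₂ n) : ℂ)

/-- `φₙ(∑ aᵢ zⁱ) = ∑ a_{in} zⁱ`. -/
noncomputable def phi (n : ℕ) (R : ℂ⟦X⟧) : ℂ⟦X⟧ :=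
  PowerSeries.mk fun i => PowerSeries.coeff (i * n) R

/-- The function
`f_{d₁,d₂}(t,z) = 1 / (∏_{i=0}^{d₁} (1 - t z^{d₁-2i}) · ∏_{i=0}^{d₂} (1 - t z^{d₂-2i}))`. -/
noncomputable def genFun (d₁ d₂ : ℕ) (t z : ℂ) : ℂ :=
  1 / ((∏ i ∈ Finset.range (d₁ + 1), (1 - t * z ^ ((d₁ : ℤ) - 2 * (i : ℤ)))) *
    ∏ i ∈ Finset.range (d₂ + 1), (1 - t * z ^ ((d₂ : ℤ) - 2 * (i : ℤ))))

/-- `f_{d,d}(t z^d, z) (1 - t z^{2k})²` as a function of `t`. -/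
noncomputable def poleCleared (d k : ℕ) (z t : ℂ) : ℂ :=
  genFun d d (t * z ^ d) z * (1 - t * z ^ (2 * k)) ^ 2

/-- The power series `A` is the expansion on `0 < |z| < 1` of
`A_k(z) = -z^{-2k} lim_{t → z^{-2k}} ∂/∂t (f_{d,d}(t z^d, z) (1 - t z^{2k})²)`
(in particular the limit exists). -/
def IsExpansionA (d k : ℕ) (A : ℂ⟦X⟧) : Prop :=
  ∀ z : ℂ, 0 < ‖z‖ → ‖z‖ < 1 → ∃ l : ℂ,
    Filter.Tendsto (fun t => deriv (poleCleared d k z) t) (𝓝[≠] (1 / z ^ (2 * k))) (𝓝 l) ∧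
    HasSum (fun n => PowerSeries.coeff n A * z ^ n) (-(1 / z ^ (2 * k)) * l)

/-- The power series `B` is the expansion on `0 < |z| < 1` of
`B_k(z) = lim_{t → z^{-2k}} f_{d,d}(t z^d, z) (1 - t z^{2k})²`
(in particular the limit exists). -/
def IsExpansionB (d k : ℕ) (B : ℂ⟦X⟧) : Prop :=
  ∀ z : ℂ, 0 < ‖z‖ → ‖z‖ < 1 → ∃ l : ℂ,
    Filter.Tendsto (fun t => poleCleared d k z t) (𝓝[≠] (1 / z ^ (2 * k))) (𝓝 l) ∧
    HasSum (fun n => PowerSeries.coeff n B * z ^ n) l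

/-!
The proof has two independent halves, an algebraic one that turns dimensions into weight
multiplicities, and an identity of power series that extracts these multiplicities.

**Dimensions.** Let `w μ` be the number of monomials of degree `n` and weight `μ` in the coordinates
of the two forms. In an `sl₂`-triple `(e, h, f)` acting on the polynomials of degree `n`, the
operator `e` is injective on negative weight spaces and maps the space of weight `μ - 2` onto that
of weight `μ` for `μ > 0` (`IsSl2Pair.raise_injective`, `IsSl2Pair.exists_raise`). Both follow from
`eq_zero_of_raise_lower`. Hence `ker e` has dimension `w 0 + w 1`, and `ker e ⊓ ker f` has dimension
`w 0 - w 2` (`IsSl2Pair.finrank_ker_raise`, `IsSl2Pair.finrank_ker_raise_ker_lower`). This applies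
to `D₁`, and, with another choice of structure constants, to the derivations by which the unipotent
triangular matrices act infinitesimally on the coefficients of forms. A polynomial is constant along
a one-parameter group iff the generator kills it (`derivation_eq_zero_iff_eval_flow`), and the
unipotent triangular matrices generate `SL₂`, so the invariants are `ker e ⊓ ker f`. Restriction to
the vector `(1, 0)` of `ℂ²` identifies the covariants with `ker e` (`covariantsEquiv`): it is
injective as `SL₂` acts transitively on nonzero vectors, and a highest weight vector `u` of weight
`m` is the leading coefficient of `∑ⱼ (-1)ʲ / j! · fʲ u · x^(m-j) yʲ`.

**Power series.** The `n`-th coefficient in `t` of `f_{d,d}(t z^d, z) = ∏_{j ≤ d} (1 - t z^(2j))⁻²`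
is the sum of `z^(nd - weight)` over the monomials of degree `n`, so `w μ` is its coefficient at
`z^(nd - μ)`. Partial fractions in `t` turn it into `∑_{j ≤ d} (A_j + (n + 1) B_j) z^(2jn)`
(`coeff_prod_mk_pow_sq`, `weightSeries_eq`). This is an identity in `ℂ⟦X⟧`: the only quotients that
occur are `1 / (1 - z^(2i) / z^(2j))`, which is a power series for `i < j` as well. Reading off the
coefficient at `z^(nd)` yields `φ_{d-2j}` and, through the factor `n + 1`, the derivative. The terms
with `2j > d` contribute nothing (`coeff_mul_weightSeries`): for `n > 0` the exponent `2jn` exceeds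
`nd`, and for `n = 0` the constant terms of `A_j` and `B_j` vanish. Finally the values of the series
`A_k` and `B_k` in the punctured disc are the limits in the statement
(`isExpansionA_simplePoleCoeff`, `isExpansionB_doublePoleCoeff`).
-/

/-! ### Weight spaces of a representation of `sl₂` -/

section Sl2

variable {M : Type*} [AddCommGroup M] [Module ℂ M] {W : ℤ → Submodule ℂ M} {e f : M →ₗ[ℂ] M}

/-- On a space of positive weight `μ`, the operator `e f` has no eigenvalue `-c` with `c ≥ 0`. The
induction is downwards on the weight: if `e f v = -c v`, then `f e v = -(c + μ) v`, so `e v` is an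
eigenvector of `e f` for the eigenvalue `-(c + μ)`, and `e v = 0` forces `v = 0`. -/
theorem eq_zero_of_raise_lower (he : ∀ μ, ∀ v ∈ W μ, e v ∈ W (μ + 2))
    (hc : ∀ μ, ∀ v ∈ W μ, e (f v) - f (e v) = (μ : ℂ) • v) {N : ℤ}
    (hN : ∀ μ, N < μ → W μ = ⊥) {μ : ℤ} (hμ : 0 < μ) {c : ℤ} (h0 : 0 ≤ c) {v : M} (hv : v ∈ W μ)
    (hev : e (f v) = -(c : ℂ) • v) : v = 0 := by
  induction hk : (N + 1 - μ).toNat using Nat.strong_induction_on generalizing μ c v with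
  | _ k ih =>
    by_cases hNμ : N < μ
    · rw [hN μ hNμ] at hv
      simpa using hv
    have hfe : f (e v) = -((c + μ : ℤ) : ℂ) • v := by
      have h := hc μ v hv
      rw [hev, sub_eq_iff_eq_add] at h
      rw [eq_sub_of_add_eq' h.symm, ← sub_smul]
      push_cast
      congr 1
      ring
    have hz : e v = 0 := by
      refine ih _ ?_ (μ := μ + 2) (c := c + μ) (by lia) (by lia) (he μ v hv) ?_ rfl
      · lia
      · rw [hfe, map_smul]
    rw [hz, map_zero, eq_comm, smul_eq_zero] at hfe
    refine hfe.resolve_left ?_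
    rw [neg_eq_zero]
    exact_mod_cast (by lia : c + μ ≠ 0)

theorem raise_lower_injective (he : ∀ μ, ∀ v ∈ W μ, e v ∈ W (μ + 2))
    (hc : ∀ μ, ∀ v ∈ W μ, e (f v) - f (e v) = (μ : ℂ) • v) {N : ℤ}
    (hN : ∀ μ, N < μ → W μ = ⊥) {μ : ℤ} (hμ : 0 < μ) {v : M} (hv : v ∈ W μ)
    (hev : e (f v) = 0) : v = 0 :=
  eq_zero_of_raise_lower he hc hN hμ le_rfl hv (by simpa using hev)

/-- The same as `raise_lower_injective`, with the roles of `e` and `f` exchanged: already `f e` is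
injective on spaces of negative weight. -/
theorem raise_injective_of_neg (hf : ∀ μ, ∀ v ∈ W μ, f v ∈ W (μ - 2))
    (hc : ∀ μ, ∀ v ∈ W μ, e (f v) - f (e v) = (μ : ℂ) • v) {N : ℤ}
    (hN : ∀ μ, μ < -N → W μ = ⊥) {μ : ℤ} (hμ : μ < 0) {v : M} (hv : v ∈ W μ)
    (hev : e v = 0) : v = 0 := by
  refine raise_lower_injective (W := fun k => W (-k)) (e := f) (f := e) (N := N) (μ := -μ)
    (fun k v hv => ?_) (fun k v hv => ?_) (fun k hk => hN _ (by lia)) (by lia) (by simpa using hv)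
    (by rw [hev, map_zero])
  · simpa [neg_add, sub_eq_add_neg, add_comm] using hf (-k) v hv
  · have h := hc (-k) v hv
    rw [← neg_sub, h]
    simp

/-- On a finite-dimensional space of positive weight `e f` is bijective, so `e` maps onto that
space. -/
theorem exists_raise_eq (he : ∀ μ, ∀ v ∈ W μ, e v ∈ W (μ + 2))
    (hf : ∀ μ, ∀ v ∈ W μ, f v ∈ W (μ - 2))
    (hc : ∀ μ, ∀ v ∈ W μ, e (f v) - f (e v) = (μ : ℂ) • v) {N : ℤ}
    (hN : ∀ μ, N < μ → W μ = ⊥) {μ : ℤ} (hμ : 0 < μ) [FiniteDimensional ℂ (W μ)] {v : M}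
    (hv : v ∈ W μ) : ∃ u ∈ W (μ - 2), e u = v := by
  let T : W μ →ₗ[ℂ] W μ := (e ∘ₗ f).restrict fun v hv => by
    simpa using he _ _ (hf μ v hv)
  have hT : Function.Injective T := by
    rw [← LinearMap.ker_eq_bot, LinearMap.ker_eq_bot']
    rintro ⟨v, hv⟩ h
    exact Subtype.ext (raise_lower_injective he hc hN hμ hv (congrArg Subtype.val h))
  obtain ⟨u, hu⟩ := LinearMap.surjective_of_injective hT ⟨v, hv⟩
  exact ⟨f u, hf μ u u.2, congrArg Subtype.val hu⟩

end Sl2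

/-! ### Derivations of a polynomial ring forming an `sl₂`-triple -/

section Weights

open MvPolynomial

variable {σ : Type*}

/-- The exponents of the monomials of degree `n` whose weight lies in `S`, where the variable `X i`
has weight `wt i`. -/
def exponentSet (wt : σ → ℤ) (n : ℕ) (S : Set ℤ) : Set (σ →₀ ℕ) :=
  {s | s.degree = n ∧ Finsupp.weight wt s ∈ S}

theorem exponentSet_finite [Finite σ] (wt : σ → ℤ) (n : ℕ) (S : Set ℤ) :
    (exponentSet wt n S).Finite :=
  (Finsupp.finite_of_degree_le n).subset fun _ hs => hs.1.le

/-- The span of the monomials of degree `n` whose weight lies in `S`. -/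
noncomputable def weightSpan (wt : σ → ℤ) (n : ℕ) (S : Set ℤ) : Submodule ℂ (MvPolynomial σ ℂ) :=
  restrictSupport ℂ (exponentSet wt n S)

theorem mem_weightSpan {wt : σ → ℤ} {n : ℕ} {S : Set ℤ} {p : MvPolynomial σ ℂ} :
    p ∈ weightSpan wt n S ↔ ∀ s, coeff s p ≠ 0 → s.degree = n ∧ Finsupp.weight wt s ∈ S := by
  simp only [weightSpan, mem_restrictSupport_iff, exponentSet, Set.subset_def, Finset.mem_coe,
    mem_support_iff, Set.mem_ofPred_eq]

theorem weightSpan_mono {wt : σ → ℤ} {n : ℕ} {S T : Set ℤ} (h : S ⊆ T) :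
    weightSpan wt n S ≤ weightSpan wt n T :=
  restrictSupport_mono (R := ℂ) fun _ hs => ⟨hs.1, h hs.2⟩

theorem weightSpan_univ (wt : σ → ℤ) (n : ℕ) :
    weightSpan wt n Set.univ = homogeneousSubmodule σ ℂ n := by
  ext p
  rw [mem_weightSpan, mem_homogeneousSubmodule]
  simp only [Set.mem_univ, and_true, IsHomogeneous, IsWeightedHomogeneous,
    Finsupp.degree_eq_weight_one]
  rfl

instance finiteDimensional_weightSpan [Finite σ] (wt : σ → ℤ) (n : ℕ) (S : Set ℤ) :
    FiniteDimensional ℂ (weightSpan wt n S) :=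
  have := (exponentSet_finite wt n S).to_subtype
  Module.Finite.of_basis (basisRestrictSupport ℂ (exponentSet wt n S))

theorem finrank_weightSpan [Finite σ] (wt : σ → ℤ) (n : ℕ) (S : Set ℤ) :
    Module.finrank ℂ (weightSpan wt n S) = (exponentSet wt n S).ncard :=
  Module.finrank_eq_nat_card_basis (basisRestrictSupport ℂ (exponentSet wt n S))

/-- The weight space of weight `μ` in degree `n`, in terms of the grading by `ℕ × ℤ`. -/
theorem weightSpan_singleton (wt : σ → ℤ) (n : ℕ) (μ : ℤ) :
    weightSpan wt n {μ} =
      weightedHomogeneousSubmodule ℂ (fun i => ((1 : ℕ), wt i)) (n, μ) := by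
  ext p
  rw [mem_weightSpan, mem_weightedHomogeneousSubmodule]
  have h (s : σ →₀ ℕ) : Finsupp.weight (fun i => ((1 : ℕ), wt i)) s =
      (s.degree, Finsupp.weight wt s) := by
    simp only [Finsupp.weight_apply, Finsupp.sum, Finsupp.degree_apply]
    ext <;> simp [Prod.fst_sum, Prod.snd_sum]
  simp only [IsWeightedHomogeneous, h, Prod.mk.injEq, Set.mem_singleton_iff]

theorem monomial_mem_weightSpan {wt : σ → ℤ} {n : ℕ} {S : Set ℤ} {s : σ →₀ ℕ} (h : s.degree = n)
    (hS : Finsupp.weight wt s ∈ S) (r : ℂ) : monomial s r ∈ weightSpan wt n S :=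
  (monomial_mem_restrictSupport ℂ).2 (Or.inl ⟨h, hS⟩)

theorem weightSpan_le {wt : σ → ℤ} {n : ℕ} {S : Set ℤ} {V : Submodule ℂ (MvPolynomial σ ℂ)}
    (h : ∀ s : σ →₀ ℕ, s.degree = n → Finsupp.weight wt s ∈ S → monomial s (1 : ℂ) ∈ V) :
    weightSpan wt n S ≤ V := by
  rw [weightSpan, restrictSupport_eq_span, Submodule.span_le]
  rintro _ ⟨s, hs, rfl⟩
  exact h s hs.1 hs.2

/-- A derivation that moves every variable by the degree `δ` moves every polynomial by `δ`. -/
theorem isWeightedHomogeneous_derivation {N : Type*} [AddCommMonoid N] {w : σ → N} {δ : N}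
    {D : Derivation ℂ (MvPolynomial σ ℂ) (MvPolynomial σ ℂ)}
    (hD : ∀ i, IsWeightedHomogeneous w (D (X i)) (w i + δ)) (s : σ →₀ ℕ) (r : ℂ) :
    IsWeightedHomogeneous w (D (monomial s r)) (Finsupp.weight w s + δ) := by
  have key : IsWeightedHomogeneous w (D (monomial s 1)) (Finsupp.weight w s + δ) := by
    induction s using Finsupp.induction_linear with
    | zero =>
      have : D (monomial 0 1) = 0 := D.map_one_eq_zero
      rw [this]
      exact isWeightedHomogeneous_zero _ _ _
    | add s t hs ht =>
      have : (monomial (s + t) (1 : ℂ)) = monomial s 1 * monomial t 1 := by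
        rw [monomial_mul, one_mul]
      rw [this, D.leibniz, smul_eq_mul, smul_eq_mul, map_add]
      refine IsWeightedHomogeneous.add ?_ ?_
      · rw [add_assoc]
        exact (isWeightedHomogeneous_monomial w s 1 rfl).mul ht
      · rw [add_comm (Finsupp.weight w s), add_assoc]
        exact (isWeightedHomogeneous_monomial w t 1 rfl).mul hs
    | single i k =>
      rw [← X_pow_eq_monomial, D.leibniz_pow, Finsupp.weight_single]
      rcases k with _ | k
      · simpa using isWeightedHomogeneous_zero _ _ _
      · refine Submodule.smul_of_tower_mem (weightedHomogeneousSubmodule ℂ w _) _ ?_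
        rw [mem_weightedHomogeneousSubmodule, succ_nsmul, add_assoc]
        exact ((isWeightedHomogeneous_X _ w i).pow k).mul (hD i)
  have : monomial s r = r • monomial s (1 : ℂ) := by simp [smul_monomial]
  rw [this, D.map_smul]
  exact (weightedHomogeneousSubmodule ℂ w _).smul_mem r key

theorem weightedHomogeneousComponent_derivation {N : Type*} [AddCancelCommMonoid N]
    {w : σ → N} {δ : N}
    {D : Derivation ℂ (MvPolynomial σ ℂ) (MvPolynomial σ ℂ)}
    (hD : ∀ i, IsWeightedHomogeneous w (D (X i)) (w i + δ)) (m : N) (p : MvPolynomial σ ℂ) :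
    weightedHomogeneousComponent w (m + δ) (D p) = D (weightedHomogeneousComponent w m p) := by
  classical
  induction p using MvPolynomial.induction_on' with
  | add p q hp hq => simp [hp, hq]
  | monomial s r =>
    have h1 := isWeightedHomogeneous_derivation hD s r
    have h2 := isWeightedHomogeneous_monomial w s r rfl
    rw [weightedHomogeneousComponent_of_mem h1, weightedHomogeneousComponent_of_mem h2]
    by_cases h : m = Finsupp.weight w s
    · simp [h]
    · rw [if_neg h, if_neg (by simpa using h), map_zero]

/-- Derivations `e`, `f` of a polynomial ring whose variables `X i` are weight vectors of weights
`wt i` for the `sl₂`-triple `(e, [e, f], f)`, acting on the linear forms. -/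
structure IsSl2Pair (wt : σ → ℤ)
    (e f : Derivation ℂ (MvPolynomial σ ℂ) (MvPolynomial σ ℂ)) : Prop where
  raise_X : ∀ i, e (X i) ∈ weightSpan wt 1 {wt i + 2}
  lower_X : ∀ i, f (X i) ∈ weightSpan wt 1 {wt i - 2}
  comm_X : ∀ i, e (f (X i)) - f (e (X i)) = (wt i : ℂ) • X i

namespace IsSl2Pair

variable {wt : σ → ℤ} {e f : Derivation ℂ (MvPolynomial σ ℂ) (MvPolynomial σ ℂ)}

theorem derivation_mem_weightSpan {δ : ℤ} {D : Derivation ℂ (MvPolynomial σ ℂ) (MvPolynomial σ ℂ)}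
    (hD : ∀ i, D (X i) ∈ weightSpan wt 1 {wt i + δ}) {n : ℕ} {μ : ℤ} {p : MvPolynomial σ ℂ}
    (hp : p ∈ weightSpan wt n {μ}) : D p ∈ weightSpan wt n {μ + δ} := by
  rw [weightSpan_singleton]
  have key : weightSpan wt n {μ} ≤
      (weightedHomogeneousSubmodule ℂ (fun i => ((1 : ℕ), wt i)) (n, μ + δ)).comap
        (D : MvPolynomial σ ℂ →ₗ[ℂ] MvPolynomial σ ℂ) := by
    refine weightSpan_le fun s hn hμ => ?_
    have h1 : monomial s (1 : ℂ) ∈ weightSpan wt n {μ} := monomial_mem_weightSpan hn hμ 1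
    rw [weightSpan_singleton, mem_weightedHomogeneousSubmodule] at h1
    have h2 := isWeightedHomogeneous_derivation (D := D) (w := fun i => ((1 : ℕ), wt i))
      (δ := ((0 : ℕ), δ)) (fun i => ?_) s 1
    · have h3 : Finsupp.weight (fun i => ((1 : ℕ), wt i)) s = (n, μ) :=
        h1 (d := s) (by classical simp [coeff_monomial])
      rw [h3] at h2
      simpa using h2
    · have := hD i
      rw [weightSpan_singleton] at this
      simpa using this
  exact key hp

theorem raise_mem (h : IsSl2Pair wt e f) {n : ℕ} {μ : ℤ} {p : MvPolynomial σ ℂ}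
    (hp : p ∈ weightSpan wt n {μ}) : e p ∈ weightSpan wt n {μ + 2} :=
  derivation_mem_weightSpan h.raise_X hp

theorem lower_mem (h : IsSl2Pair wt e f) {n : ℕ} {μ : ℤ} {p : MvPolynomial σ ℂ}
    (hp : p ∈ weightSpan wt n {μ}) : f p ∈ weightSpan wt n {μ - 2} :=
  derivation_mem_weightSpan (δ := -2) h.lower_X hp

theorem comm (h : IsSl2Pair wt e f) {n : ℕ} {μ : ℤ} {p : MvPolynomial σ ℂ}
    (hp : p ∈ weightSpan wt n {μ}) : e (f p) - f (e p) = (μ : ℂ) • p := by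
  have hb : ⁅e, f⁆ = mkDerivation ℂ fun i => (wt i : ℂ) • X i :=
    derivation_ext fun i => by simp [Derivation.commutator_apply, h.comm_X]
  have key : weightSpan wt n {μ} ≤ LinearMap.eqLocus
      (⁅e, f⁆ : Derivation ℂ (MvPolynomial σ ℂ) (MvPolynomial σ ℂ)).toLinearMap
      ((μ : ℂ) • LinearMap.id) := by
    refine weightSpan_le fun s _ hμ => ?_
    rw [LinearMap.mem_eqLocus, hb]
    change mkDerivation ℂ _ _ = (μ : ℂ) • monomial s (1 : ℂ)
    rw [Set.mem_singleton_iff] at hμ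
    rw [mkDerivation_monomial, one_smul, ← hμ, Finsupp.weight_apply]
    simp only [Finsupp.sum, Int.cast_sum, Finset.sum_smul]
    refine Finset.sum_congr rfl fun i hi => ?_
    rw [smul_eq_mul, mul_smul_comm, X, monomial_mul, Finsupp.sub_add_single_one_cancel]
    · simp [smul_monomial, mul_comm]
    · simpa using hi
  have := key hp
  rw [LinearMap.mem_eqLocus] at this
  rw [← Derivation.commutator_apply]
  exact this

theorem exists_weight_bound [Finite σ] (wt : σ → ℤ) (n : ℕ) :
    ∃ N : ℤ, ∀ μ, N < |μ| → weightSpan wt n {μ} = ⊥ := by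
  obtain ⟨N, hN⟩ := ((exponentSet_finite wt n Set.univ).image
    fun s => |Finsupp.weight wt s|).bddAbove
  refine ⟨N, fun μ hμ => ?_⟩
  rw [eq_bot_iff]
  refine weightSpan_le fun s hs hsμ => ?_
  have h1 := hN ⟨s, ⟨hs, Set.mem_univ _⟩, rfl⟩
  rw [Set.mem_singleton_iff] at hsμ
  simp only [hsμ] at h1
  exact absurd h1 (not_le.2 hμ)

variable [Finite σ]

theorem raise_injective (h : IsSl2Pair wt e f) {n : ℕ} {μ : ℤ} (hμ : μ < 0) {p : MvPolynomial σ ℂ}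
    (hp : p ∈ weightSpan wt n {μ}) (he : e p = 0) : p = 0 := by
  obtain ⟨N, hN⟩ := exists_weight_bound wt n
  exact raise_injective_of_neg (W := fun μ => weightSpan wt n {μ}) (e := e.toLinearMap)
    (f := f.toLinearMap) (fun _ _ => h.lower_mem) (fun _ _ => h.comm) (N := N)
    (fun μ hμ => hN μ (lt_abs.2 (Or.inr (by lia)))) hμ hp he

theorem exists_raise (h : IsSl2Pair wt e f) {n : ℕ} {μ : ℤ} (hμ : 0 < μ) {p : MvPolynomial σ ℂ}
    (hp : p ∈ weightSpan wt n {μ}) : ∃ q ∈ weightSpan wt n {μ - 2}, e q = p := by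
  obtain ⟨N, hN⟩ := exists_weight_bound wt n
  exact exists_raise_eq (W := fun μ => weightSpan wt n {μ}) (e := e.toLinearMap)
    (f := f.toLinearMap) (fun _ _ => h.raise_mem) (fun _ _ => h.lower_mem) (fun _ _ => h.comm)
    (N := N) (fun μ hμ => hN μ (lt_abs.2 (Or.inl (by lia)))) hμ hp

end IsSl2Pair

end Weights

/-! ### Kernels of the raising and lowering operators -/

section Kernels

open MvPolynomial

variable {σ : Type*} {wt : σ → ℤ} {e f : Derivation ℂ (MvPolynomial σ ℂ) (MvPolynomial σ ℂ)}

namespace IsSl2Pair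

theorem weightedHomogeneousComponent_raise (h : IsSl2Pair wt e f) (n : ℕ) (μ : ℤ)
    (p : MvPolynomial σ ℂ) :
    weightedHomogeneousComponent (fun i => ((1 : ℕ), wt i)) (n, μ + 2) (e p) =
      e (weightedHomogeneousComponent (fun i => ((1 : ℕ), wt i)) (n, μ) p) := by
  rw [← weightedHomogeneousComponent_derivation (δ := ((0 : ℕ), (2 : ℤ)))]
  · simp
  · intro i
    have := h.raise_X i
    rw [weightSpan_singleton] at this
    simpa using this

theorem symm (h : IsSl2Pair wt e f) : IsSl2Pair (-wt) f e := by
  have hneg (n : ℕ) (μ : ℤ) : weightSpan (-wt) n {μ} = weightSpan wt n {-μ} := by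
    have hw (s : σ →₀ ℕ) : Finsupp.weight (-wt) s = -Finsupp.weight wt s := by
      simp [Finsupp.weight_apply, Finsupp.sum]
    ext p
    simp only [mem_weightSpan, hw, Set.mem_singleton_iff, neg_eq_iff_eq_neg]
  refine ⟨fun i => ?_, fun i => ?_, fun i => ?_⟩
  · simpa [hneg, sub_eq_add_neg, add_comm] using h.lower_X i
  · simpa [hneg, sub_eq_add_neg, add_comm] using h.raise_X i
  · rw [← neg_sub, h.comm_X]
    simp

variable [Finite σ]

/-- A semi-invariant has no component of negative weight. -/
theorem mem_weightSpan_of_raise_eq_zero (h : IsSl2Pair wt e f) {n : ℕ} {p : MvPolynomial σ ℂ}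
    (hp : p ∈ weightSpan wt n Set.univ) (he : e p = 0) : p ∈ weightSpan wt n (Set.Ici 0) := by
  classical
  rw [mem_weightSpan] at hp ⊢
  intro s hs
  refine ⟨(hp s hs).1, ?_⟩
  by_contra hneg
  rw [Set.mem_Ici, not_le] at hneg
  have h0 := h.raise_injective hneg (n := n) (p := weightedHomogeneousComponent
    (fun i => ((1 : ℕ), wt i)) (n, Finsupp.weight wt s) p)
    (by rw [weightSpan_singleton]; exact weightedHomogeneousComponent_mem _ _ _)
    (by rw [← h.weightedHomogeneousComponent_raise, he, map_zero])
  have h1 := congrArg (coeff s) h0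
  have h2 : Finsupp.weight (fun i => ((1 : ℕ), wt i)) s = (n, Finsupp.weight wt s) := by
    have h3 := monomial_mem_weightSpan (wt := wt) (hp s hs).1 (Set.mem_singleton _) (1 : ℂ)
    rw [weightSpan_singleton] at h3
    exact h3 (d := s) (by simp [coeff_monomial])
  rw [coeff_weightedHomogeneousComponent, if_pos h2, coeff_zero] at h1
  exact hs h1

/-- The semi-invariants are spanned by weight vectors of nonnegative weight. -/
theorem ker_raise_le (h : IsSl2Pair wt e f) {n : ℕ} {V : Submodule ℂ (MvPolynomial σ ℂ)}
    (hV : ∀ μ, 0 ≤ μ → ∀ u ∈ weightSpan wt n {μ}, e u = 0 → u ∈ V) {p : MvPolynomial σ ℂ}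
    (hp : p ∈ weightSpan wt n Set.univ) (he : e p = 0) : p ∈ V := by
  classical
  rw [← finsum_weightedHomogeneousComponent (fun i => ((1 : ℕ), wt i)) p]
  refine finsum_induction (· ∈ V) V.zero_mem (fun _ _ => V.add_mem) ?_
  rintro ⟨m, μ⟩
  have hu : weightedHomogeneousComponent (fun i => ((1 : ℕ), wt i)) (m, μ) p ∈
      weightSpan wt m {μ} := by
    rw [weightSpan_singleton]
    exact weightedHomogeneousComponent_mem _ _ _
  have heu : e (weightedHomogeneousComponent (fun i => ((1 : ℕ), wt i)) (m, μ) p) = 0 := by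
    rw [← h.weightedHomogeneousComponent_raise, he, map_zero]
  by_cases hm : m = n
  · subst hm
    by_cases hμ : 0 ≤ μ
    · exact hV μ hμ _ hu heu
    · rw [h.raise_injective (not_le.1 hμ) hu heu]
      exact V.zero_mem
  · convert V.zero_mem
    ext s
    by_contra hs
    rw [coeff_zero] at hs
    refine hm ((mem_weightSpan.1 hu s hs).1.symm.trans (mem_weightSpan.1 hp s ?_).1)
    rw [coeff_weightedHomogeneousComponent] at hs
    exact fun h0 => hs (by simp [h0])

theorem map_raise_weightSpan (h : IsSl2Pair wt e f) {n : ℕ} {k : ℤ} (hk : -1 ≤ k) :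
    (weightSpan wt n (Set.Ici k)).map e.toLinearMap = weightSpan wt n (Set.Ici (k + 2)) := by
  refine le_antisymm ?_ (weightSpan_le fun s hn hs => ?_)
  · rw [Submodule.map_le_iff_le_comap]
    refine weightSpan_le fun s hn hs => ?_
    refine weightSpan_mono ?_
      (h.raise_mem (monomial_mem_weightSpan hn (Set.mem_singleton (Finsupp.weight wt s)) 1))
    rw [Set.singleton_subset_iff, Set.mem_Ici]
    exact add_le_add_left hs 2
  · rw [Set.mem_Ici] at hs
    obtain ⟨q, hq, hqs⟩ := h.exists_raise (by lia)
      (monomial_mem_weightSpan hn (Set.mem_singleton (Finsupp.weight wt s)) 1)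
    refine ⟨q, weightSpan_mono ?_ hq, hqs⟩
    rw [Set.singleton_subset_iff, Set.mem_Ici]
    lia

theorem finrank_inf_ker {M : Type*} [AddCommGroup M] [Module ℂ M] (T : M →ₗ[ℂ] M)
    (U : Submodule ℂ M) [FiniteDimensional ℂ U] :
    Module.finrank ℂ (U ⊓ LinearMap.ker T : Submodule ℂ M) + Module.finrank ℂ (U.map T) =
      Module.finrank ℂ U := by
  rw [← LinearMap.range_domRestrict, ← LinearMap.finrank_range_add_finrank_ker (T.domRestrict U),
    add_comm, ← Submodule.map_comap_subtype]
  congr 1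
  exact (Submodule.equivMapOfInjective U.subtype U.subtype_injective _).finrank_eq.symm

/-- **Dimension of the space of semi-invariants**: it is the sum of the multiplicities of the
weights `0` and `1`. -/
theorem finrank_ker_raise (h : IsSl2Pair wt e f) (n : ℕ) :
    Module.finrank ℂ (LinearMap.ker e.toLinearMap ⊓ homogeneousSubmodule σ ℂ n :
      Submodule ℂ (MvPolynomial σ ℂ)) =
      (exponentSet wt n {0}).ncard + (exponentSet wt n {1}).ncard := by
  have hle : LinearMap.ker e.toLinearMap ⊓ homogeneousSubmodule σ ℂ n =
      weightSpan wt n (Set.Ici 0) ⊓ LinearMap.ker e.toLinearMap := by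
    rw [← weightSpan_univ wt]
    ext p
    exact ⟨fun hp => ⟨h.mem_weightSpan_of_raise_eq_zero hp.2 hp.1, hp.1⟩,
      fun hp => ⟨hp.2, weightSpan_mono (Set.subset_univ _) hp.1⟩⟩
  have hdim := finrank_inf_ker e.toLinearMap (weightSpan wt n (Set.Ici 0))
  rw [h.map_raise_weightSpan (by lia), finrank_weightSpan, finrank_weightSpan, ← hle] at hdim
  have hunion : exponentSet wt n (Set.Ici 0) =
      (exponentSet wt n {0} ∪ exponentSet wt n {1}) ∪ exponentSet wt n (Set.Ici (0 + 2)) := by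
    ext s
    simp only [exponentSet, Set.mem_union, Set.mem_ofPred_eq, Set.mem_Ici, Set.mem_singleton_iff]
    lia
  rw [hunion, Set.ncard_union_eq _ ((exponentSet_finite _ _ _).union (exponentSet_finite _ _ _))
    (exponentSet_finite _ _ _), Set.ncard_union_eq _ (exponentSet_finite _ _ _)
    (exponentSet_finite _ _ _)] at hdim
  · exact Nat.add_right_cancel hdim
  · rw [Set.disjoint_left]
    rintro s ⟨-, hs⟩ ⟨-, hs'⟩
    rw [Set.mem_singleton_iff] at hs hs'
    lia
  · rw [Set.disjoint_left]
    rintro s (⟨-, hs⟩ | ⟨-, hs⟩) ⟨-, hs'⟩ <;>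
    · rw [Set.mem_singleton_iff] at hs
      rw [Set.mem_Ici] at hs'
      lia

/-- A vector killed by `e` and `f` is killed by `[e, f]`, so it has weight `0`. -/
theorem mem_weightSpan_zero (h : IsSl2Pair wt e f) {n : ℕ} {p : MvPolynomial σ ℂ}
    (hp : p ∈ weightSpan wt n Set.univ) (he : e p = 0) (hf : f p = 0) :
    p ∈ weightSpan wt n {0} := by
  have h1 := h.mem_weightSpan_of_raise_eq_zero hp he
  have h2 := h.symm.mem_weightSpan_of_raise_eq_zero (by rwa [weightSpan_univ] at hp ⊢) hf
  rw [mem_weightSpan] at h1 h2 ⊢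
  refine fun s hs => ⟨(h1 s hs).1, ?_⟩
  have hw : Finsupp.weight (-wt) s = -Finsupp.weight wt s := by
    simp [Finsupp.weight_apply, Finsupp.sum]
  have h3 := (h1 s hs).2
  have h4 := (h2 s hs).2
  rw [Set.mem_Ici] at h3 h4
  rw [Set.mem_singleton_iff]
  lia

/-- **Dimension of the space of invariants**: the difference of the multiplicities of the weights
`0` and `2`. -/
theorem finrank_ker_raise_ker_lower (h : IsSl2Pair wt e f) (n : ℕ) :
    Module.finrank ℂ (LinearMap.ker e.toLinearMap ⊓ LinearMap.ker f.toLinearMap ⊓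
      homogeneousSubmodule σ ℂ n : Submodule ℂ (MvPolynomial σ ℂ)) +
      (exponentSet wt n {2}).ncard = (exponentSet wt n {0}).ncard := by
  have hle : LinearMap.ker e.toLinearMap ⊓ LinearMap.ker f.toLinearMap ⊓
      homogeneousSubmodule σ ℂ n = weightSpan wt n {0} ⊓ LinearMap.ker e.toLinearMap := by
    rw [← weightSpan_univ wt]
    ext p
    refine ⟨fun hp => ⟨h.mem_weightSpan_zero hp.2 hp.1.1 hp.1.2, hp.1.1⟩, fun hp =>
      ⟨⟨hp.2, ?_⟩, weightSpan_mono (Set.subset_univ _) hp.1⟩⟩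
    -- `f p` has weight `-2` and `e (f p) = [e, f] p + f (e p) = 0`
    have hc := h.comm hp.1
    have he : e p = 0 := hp.2
    rw [he, map_zero, sub_zero, Int.cast_zero, zero_smul] at hc
    exact h.raise_injective (by lia) (h.lower_mem hp.1) hc
  have hmap : (weightSpan wt n {0}).map e.toLinearMap = weightSpan wt n {2} := by
    refine le_antisymm ?_ fun q hq => ?_
    · rintro _ ⟨q, hq, rfl⟩
      simpa using h.raise_mem hq
    · obtain ⟨u, hu, huq⟩ := h.exists_raise (by lia) hq
      exact ⟨u, by simpa using hu, huq⟩
  have hdim := finrank_inf_ker e.toLinearMap (weightSpan wt n {0})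
  rwa [hmap, finrank_weightSpan, finrank_weightSpan, ← hle] at hdim

end IsSl2Pair

end Kernels

/-! ### Two `sl₂`-triples on the coordinates of pairs of binary forms -/

section Ladder

open MvPolynomial

/-- The weight `dⱼ - 2i` of the `i`-th coordinate on the summand `V_{dⱼ}`. -/
def formWeight (d₁ d₂ : ℕ) : FormIdx d₁ d₂ → ℤ :=
  Sum.elim (fun i => (d₁ : ℤ) - 2 * (i : ℕ)) (fun i => (d₂ : ℤ) - 2 * (i : ℕ))

/-- The derivation `Xᵢ ↦ α d i • Xᵢ₋₁` on the coordinates of both summands. The truncation at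
`i = 0` is harmless because `α d 0 = 0` wherever this is used. -/
noncomputable def ladderUp (α : ℕ → ℕ → ℂ) (d₁ d₂ : ℕ) :
    Derivation ℂ (MvPolynomial (FormIdx d₁ d₂) ℂ) (MvPolynomial (FormIdx d₁ d₂) ℂ) :=
  mkDerivation ℂ (Sum.elim
    (fun i : Fin (d₁ + 1) => α d₁ i •
      X (Sum.inl ⟨(i : ℕ) - 1, lt_of_le_of_lt (Nat.sub_le _ _) i.isLt⟩))
    (fun i : Fin (d₂ + 1) => α d₂ i •
      X (Sum.inr ⟨(i : ℕ) - 1, lt_of_le_of_lt (Nat.sub_le _ _) i.isLt⟩)))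

/-- The derivation `Xᵢ ↦ β d i • Xᵢ₊₁` on the coordinates of both summands. The truncation at
`i = d` is harmless because `β d d = 0` wherever this is used. -/
noncomputable def ladderDown (β : ℕ → ℕ → ℂ) (d₁ d₂ : ℕ) :
    Derivation ℂ (MvPolynomial (FormIdx d₁ d₂) ℂ) (MvPolynomial (FormIdx d₁ d₂) ℂ) :=
  mkDerivation ℂ (Sum.elim
    (fun i : Fin (d₁ + 1) => β d₁ i •
      X (Sum.inl ⟨min ((i : ℕ) + 1) d₁, Nat.lt_succ_of_le (min_le_right _ _)⟩))
    (fun i : Fin (d₂ + 1) => β d₂ i •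
      X (Sum.inr ⟨min ((i : ℕ) + 1) d₂, Nat.lt_succ_of_le (min_le_right _ _)⟩)))

theorem X_mem_weightSpan {σ : Type*} (wt : σ → ℤ) (i : σ) (r : ℂ) {μ : ℤ} (h : r ≠ 0 → wt i = μ) :
    r • (X i : MvPolynomial σ ℂ) ∈ weightSpan wt 1 {μ} := by
  by_cases hr : r = 0
  · simp [hr]
  · rw [X, smul_monomial]
    exact monomial_mem_weightSpan (Finsupp.degree_single _ _)
      (by simp [Finsupp.weight_single, h hr]) _

theorem isSl2Pair_ladder {α β : ℕ → ℕ → ℂ} (hα : ∀ d, α d 0 = 0) (hβ : ∀ d, β d d = 0)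
    (hc : ∀ d i, i ≤ d → β d i * α d (i + 1) - α d i * β d (i - 1) = (d : ℂ) - 2 * i)
    (d₁ d₂ : ℕ) :
    IsSl2Pair (formWeight d₁ d₂) (ladderUp α d₁ d₂) (ladderDown β d₁ d₂) := by
  have hup (d i : ℕ) (h : α d i ≠ 0) : (d : ℤ) - 2 * (i - 1 : ℕ) = d - 2 * i + 2 := by
    have : i ≠ 0 := by
      rintro rfl
      exact h (hα d)
    lia
  have hdn (d i : ℕ) (hi : i < d + 1) (h : β d i ≠ 0) :
      (d : ℤ) - 2 * (min (i + 1) d : ℕ) = d - 2 * i - 2 := by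
    have : i ≠ d := by
      rintro rfl
      exact h (hβ i)
    lia
  -- the truncated indices do not matter in the commutator
  have hcomm {σ : Type} (d : ℕ) (x : Fin (d + 1) → MvPolynomial σ ℂ) (i : Fin (d + 1)) :
      (β d i * α d (min ((i : ℕ) + 1) d : ℕ)) •
        x ⟨min ((i : ℕ) + 1) d - 1, lt_of_le_of_lt (Nat.sub_le _ _)
          (Nat.lt_succ_of_le (min_le_right _ _))⟩ -
      (α d i * β d ((i : ℕ) - 1)) •
        x ⟨min ((i : ℕ) - 1 + 1) d, Nat.lt_succ_of_le (min_le_right _ _)⟩ =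
      ((d : ℂ) - 2 * (i : ℕ)) • x i := by
    rw [← hc d i (Nat.lt_succ_iff.1 i.2), sub_smul]
    have hi := i.2
    congr 1
    · by_cases h : (i : ℕ) = d
      · simp [h, hβ]
      · have h1 : min ((i : ℕ) + 1) d = i + 1 := by lia
        simp only [h1, Nat.add_sub_cancel]
    · by_cases h : (i : ℕ) = 0
      · simp [h, hα]
      · have h1 : min ((i : ℕ) - 1 + 1) d = i := by lia
        simp only [h1]
  refine ⟨?_, ?_, ?_⟩
  · rintro (i | i) <;> simp only [ladderUp, mkDerivation_X, Sum.elim_inl, Sum.elim_inr]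
    · exact X_mem_weightSpan _ _ _ fun h => hup d₁ i h
    · exact X_mem_weightSpan _ _ _ fun h => hup d₂ i h
  · rintro (i | i) <;> simp only [ladderDown, mkDerivation_X, Sum.elim_inl, Sum.elim_inr]
    · exact X_mem_weightSpan _ _ _ fun h => hdn d₁ i i.2 h
    · exact X_mem_weightSpan _ _ _ fun h => hdn d₂ i i.2 h
  · rintro (i | i) <;>
      simp only [ladderUp, ladderDown, mkDerivation_X, Sum.elim_inl, Sum.elim_inr,
        Derivation.map_smul, smul_smul, formWeight]
    · exact (hcomm d₁ (fun i => X (Sum.inl i)) i).trans (by simp)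
    · exact (hcomm d₂ (fun i => X (Sum.inr i)) i).trans (by simp)

/-- `D₁` is the raising operator of an `sl₂`-triple. -/
theorem isSl2Pair_raisingDerivation (d₁ d₂ : ℕ) :
    IsSl2Pair (formWeight d₁ d₂) (raisingDerivation d₁ d₂)
      (ladderDown (fun d i => (d : ℂ) - i) d₁ d₂) := by
  refine isSl2Pair_ladder (α := fun _ i => (i : ℂ)) (by simp) (by simp) (fun d i _ => ?_) d₁ d₂
  rcases i with _ | i
  · simp
  · push_cast [Nat.add_sub_cancel]
    ring

/-- The infinitesimal action of the upper triangular unipotent matrices on the coefficients of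
binary forms: `aᵢ ↦ -(d - i + 1) aᵢ₋₁`. -/
noncomputable def upperDerivation (d₁ d₂ : ℕ) :
    Derivation ℂ (MvPolynomial (FormIdx d₁ d₂) ℂ) (MvPolynomial (FormIdx d₁ d₂) ℂ) :=
  ladderUp (fun d i => if i = 0 then 0 else -((d : ℂ) - i + 1)) d₁ d₂

/-- The infinitesimal action of the lower triangular unipotent matrices on the coefficients of
binary forms: `aᵢ ↦ -(i + 1) aᵢ₊₁`. -/
noncomputable def lowerDerivation (d₁ d₂ : ℕ) :
    Derivation ℂ (MvPolynomial (FormIdx d₁ d₂) ℂ) (MvPolynomial (FormIdx d₁ d₂) ℂ) :=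
  ladderDown (fun d i => if i = d then 0 else -((i : ℂ) + 1)) d₁ d₂

theorem isSl2Pair_upper_lower (d₁ d₂ : ℕ) :
    IsSl2Pair (formWeight d₁ d₂) (upperDerivation d₁ d₂) (lowerDerivation d₁ d₂) := by
  refine isSl2Pair_ladder (by simp) (by simp) (fun d i hi => ?_) d₁ d₂
  rcases i with _ | i
  · by_cases h : 0 = d
    · simp [← h]
    · simp [h]
  · have hne : i ≠ d := by lia
    by_cases h : i + 1 = d
    · subst h
      simp
      ring
    · simp [h, hne]
      ring

end Ladder

/-! ### Derivations as infinitesimal generators -/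

section IntegralCurves

open MvPolynomial

variable {σ : Type*} {D : Derivation ℂ (MvPolynomial σ ℂ) (MvPolynomial σ ℂ)}

/-- The chain rule along an integral curve of the vector field `D`. -/
theorem hasDerivAt_eval_integralCurve {γ : ℂ → σ → ℂ} {s : ℂ}
    (h : ∀ i, HasDerivAt (fun t => γ t i) (eval (γ s) (D (X i))) s) (P : MvPolynomial σ ℂ) :
    HasDerivAt (fun t => eval (γ t) P) (eval (γ s) (D P)) s := by
  induction P using MvPolynomial.induction_on with
  | C r => simpa using hasDerivAt_const s r
  | add p q hp hq => simpa using hp.fun_add hq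
  | mul_X p i hp =>
    simp only [map_mul, eval_X, Derivation.leibniz, smul_eq_mul, map_add]
    exact (hp.fun_mul (h i)).congr_deriv (by ring)

/-- A polynomial is constant along the flow of a vector field iff the vector field kills it. -/
theorem derivation_eq_zero_iff_eval_flow {γ : (σ → ℂ) → ℂ → σ → ℂ} (h0 : ∀ x, γ x 0 = x)
    (h : ∀ x s i, HasDerivAt (fun t => γ x t i) (eval (γ x s) (D (X i))) s)
    (P : MvPolynomial σ ℂ) : D P = 0 ↔ ∀ x t, eval (γ x t) P = eval x P := by
  constructor
  · intro hP x t
    have hd (s : ℂ) : HasDerivAt (fun t => eval (γ x t) P) 0 s := by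
      simpa [hP] using hasDerivAt_eval_integralCurve (h x s) P
    have := is_const_of_deriv_eq_zero (fun s => (hd s).differentiableAt) (fun s => (hd s).deriv) t 0
    simpa [h0] using this
  · intro hP
    refine MvPolynomial.funext fun x => ?_
    have hd := hasDerivAt_eval_integralCurve (h x 0) P
    simp only [hP x, h0] at hd
    rw [map_zero]
    exact hd.unique (hasDerivAt_const 0 _)

end IntegralCurves

/-! ### The action of `SL₂` on binary forms -/

section Action

open MvPolynomial

theorem formAct_mul (g h : Matrix.SpecialLinearGroup (Fin 2) ℂ) (f : MvPolynomial (Fin 2) ℂ) :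
    formAct (g * h) f = formAct g (formAct h f) := by
  unfold formAct
  rw [comp_aeval_apply]
  refine congrArg (fun v => aeval v f) (funext fun i => ?_)
  simp only [mul_inv_rev, Matrix.SpecialLinearGroup.coe_mul, Matrix.mul_apply, Fin.sum_univ_two,
    map_add, map_mul, aeval_X]
  simp only [← algebraMap_eq, AlgHom.commutes]
  ring

theorem formAct_one (f : MvPolynomial (Fin 2) ℂ) : formAct 1 f = f := by
  have : (aeval fun i => ∑ j : Fin 2, C (((1 : Matrix.SpecialLinearGroup (Fin 2) ℂ)⁻¹).1 i j) *
      (X j : MvPolynomial (Fin 2) ℂ)) = AlgHom.id ℂ (MvPolynomial (Fin 2) ℂ) := by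
    refine MvPolynomial.algHom_ext fun i => ?_
    fin_cases i <;> simp
  unfold formAct
  rw [this, AlgHom.id_apply]

theorem isHomogeneous_binaryForm (d : ℕ) (a : Fin (d + 1) → ℂ) :
    (binaryForm d a).IsHomogeneous d := by
  refine IsHomogeneous.sum _ _ _ fun i _ => ?_
  have h := ((isHomogeneous_X_pow (R := ℂ) (0 : Fin 2) (d - (i : ℕ))).mul
    (isHomogeneous_X_pow (R := ℂ) (1 : Fin 2) (i : ℕ)))
  rw [Nat.sub_add_cancel (Nat.lt_succ_iff.1 i.2)] at h
  simpa using (isHomogeneous_C (Fin 2) (a i)).mul h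

theorem isHomogeneous_formAct (g : Matrix.SpecialLinearGroup (Fin 2) ℂ)
    {f : MvPolynomial (Fin 2) ℂ} {d : ℕ} (hf : f.IsHomogeneous d) :
    (formAct g f).IsHomogeneous d := by
  have := hf.aeval (φ := f) (fun i => ∑ j : Fin 2,
    C ((g⁻¹).1 i j) * (X j : MvPolynomial (Fin 2) ℂ)) (n := 1) fun i =>
      IsHomogeneous.sum _ _ _ fun j _ => by
        simpa using (isHomogeneous_C (Fin 2) ((g⁻¹).1 i j)).mul (isHomogeneous_X ℂ j)
  simpa [formAct] using this

theorem binaryForm_eq_sum_monomial (d : ℕ) (a : Fin (d + 1) → ℂ) :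
    binaryForm d a = ∑ i : Fin (d + 1),
      monomial (Finsupp.single 0 (d - (i : ℕ)) + Finsupp.single 1 (i : ℕ)) (a i) := by
  refine Finset.sum_congr rfl fun i _ => ?_
  rw [X_pow_eq_monomial, X_pow_eq_monomial, monomial_mul, C_mul_monomial]
  simp

theorem coeff_binaryForm (d : ℕ) (a : Fin (d + 1) → ℂ) (i : Fin (d + 1)) :
    coeff (Finsupp.single (0 : Fin 2) (d - (i : ℕ)) + Finsupp.single (1 : Fin 2) (i : ℕ))
      (binaryForm d a) = a i := by
  classical
  rw [binaryForm_eq_sum_monomial, coeff_sum, Finset.sum_eq_single i]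
  · simp
  · intro j _ hj
    rw [coeff_monomial, if_neg]
    intro h
    have := DFunLike.congr_fun h 1
    simp at this
    exact hj (Fin.ext this)
  · simp

theorem binaryForm_coeff {d : ℕ} {f : MvPolynomial (Fin 2) ℂ} (hf : f.IsHomogeneous d) :
    binaryForm d (fun i => coeff
      (Finsupp.single (0 : Fin 2) (d - (i : ℕ)) + Finsupp.single (1 : Fin 2) (i : ℕ)) f) = f := by
  classical
  ext m
  by_cases hm : m.degree = d
  · have hd : m 0 + m 1 = d := by
      rw [← hm, Finsupp.degree_eq_sum, Fin.sum_univ_two]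
    have hm1 : m 1 < d + 1 := by lia
    have hme : m = Finsupp.single (0 : Fin 2) (d - m 1) + Finsupp.single (1 : Fin 2) (m 1) := by
      ext i
      fin_cases i
      · simp
        lia
      · simp
    have := coeff_binaryForm d (fun i => coeff
      (Finsupp.single (0 : Fin 2) (d - (i : ℕ)) + Finsupp.single (1 : Fin 2) (i : ℕ)) f) ⟨m 1, hm1⟩
    simpa only [← hme] using this
  · rw [(isHomogeneous_binaryForm d _).coeff_eq_zero hm, hf.coeff_eq_zero hm]

theorem binaryForm_coeffAct (d : ℕ) (g : Matrix.SpecialLinearGroup (Fin 2) ℂ)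
    (a : Fin (d + 1) → ℂ) : binaryForm d (coeffAct d g a) = formAct g (binaryForm d a) :=
  binaryForm_coeff (isHomogeneous_formAct g (isHomogeneous_binaryForm d a))

theorem coeffAct_mul (d : ℕ) (g h : Matrix.SpecialLinearGroup (Fin 2) ℂ) (a : Fin (d + 1) → ℂ) :
    coeffAct d (g * h) a = coeffAct d g (coeffAct d h a) := by
  funext i
  simp only [coeffAct, formAct_mul]
  rw [← binaryForm_coeffAct]

theorem coeffAct_one (d : ℕ) (a : Fin (d + 1) → ℂ) : coeffAct d 1 a = a := by
  funext i
  rw [coeffAct, formAct_one, coeff_binaryForm]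

/-- The upper triangular unipotent matrix with entry `s`. -/
def upperUnipotent (s : ℂ) : Matrix.SpecialLinearGroup (Fin 2) ℂ :=
  ⟨!![1, s; 0, 1], by simp⟩

/-- The lower triangular unipotent matrix with entry `s`. -/
def lowerUnipotent (s : ℂ) : Matrix.SpecialLinearGroup (Fin 2) ℂ :=
  ⟨!![1, 0; s, 1], by simp⟩

theorem coe_upperUnipotent (s : ℂ) :
    (upperUnipotent s : Matrix (Fin 2) (Fin 2) ℂ) = !![1, s; 0, 1] := rfl

theorem coe_lowerUnipotent (s : ℂ) :
    (lowerUnipotent s : Matrix (Fin 2) (Fin 2) ℂ) = !![1, 0; s, 1] := rfl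

theorem upperUnipotent_zero : upperUnipotent 0 = 1 := by
  ext i j
  fin_cases i <;> fin_cases j <;> rfl

theorem lowerUnipotent_zero : lowerUnipotent 0 = 1 := by
  ext i j
  fin_cases i <;> fin_cases j <;> rfl

/-- `SL₂` is generated by unipotent triangular matrices. -/
theorem specialLinearGroup_induction {p : Matrix.SpecialLinearGroup (Fin 2) ℂ → Prop}
    (hu : ∀ s, p (upperUnipotent s)) (hl : ∀ s, p (lowerUnipotent s))
    (hmul : ∀ g h, p g → p h → p (g * h)) (g : Matrix.SpecialLinearGroup (Fin 2) ℂ) : p g := by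
  -- a matrix whose lower left entry is not zero is a product of three unipotent matrices
  have key (g : Matrix.SpecialLinearGroup (Fin 2) ℂ) (hg : g.1 1 0 ≠ 0) : p g := by
    have hdet := g.2
    rw [Matrix.det_fin_two] at hdet
    have : g = upperUnipotent ((g.1 0 0 - 1) / g.1 1 0) * lowerUnipotent (g.1 1 0) *
        upperUnipotent ((g.1 1 1 - 1) / g.1 1 0) := by
      refine Subtype.ext ?_
      rw [Matrix.SpecialLinearGroup.coe_mul, Matrix.SpecialLinearGroup.coe_mul,
        coe_upperUnipotent, coe_upperUnipotent, coe_lowerUnipotent]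
      ext i j
      fin_cases i <;> fin_cases j <;>
        simp [Matrix.mul_apply, Fin.sum_univ_two] <;>
        field_simp
      · ring
      · linear_combination -hdet
      · ring
    rw [this]
    exact hmul _ _ (hmul _ _ (hu _) (hl _)) (hu _)
  by_cases hg : g.1 1 0 = 0
  · have hdet := g.2
    rw [Matrix.det_fin_two, hg, mul_zero, sub_zero] at hdet
    -- multiplication by a unipotent matrix makes the lower left entry nonzero
    have h : g = g * lowerUnipotent 1 * lowerUnipotent (-1) := by
      have : lowerUnipotent 1 * lowerUnipotent (-1) = 1 := by
        refine Subtype.ext ?_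
        rw [Matrix.SpecialLinearGroup.coe_mul, coe_lowerUnipotent, coe_lowerUnipotent,
          Matrix.SpecialLinearGroup.coe_one]
        ext i j
        fin_cases i <;> fin_cases j <;> simp [Matrix.mul_apply, Fin.sum_univ_two]
      rw [mul_assoc, this, mul_one]
    rw [h]
    refine hmul _ _ (key _ ?_) (hl _)
    rw [Matrix.SpecialLinearGroup.coe_mul, coe_lowerUnipotent]
    simpa [Matrix.mul_apply, Fin.sum_univ_two, hg] using right_ne_zero_of_mul_eq_one hdet
  · exact key g hg

/-- `G'` is the coefficientwise derivative of the family `G` of polynomials at `s`. -/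
def HasCoeffDerivAt (G : ℂ → MvPolynomial (Fin 2) ℂ) (G' : MvPolynomial (Fin 2) ℂ) (s : ℂ) : Prop :=
  ∀ m, HasDerivAt (fun t => coeff m (G t)) (coeff m G') s

theorem HasCoeffDerivAt.mul {G H : ℂ → MvPolynomial (Fin 2) ℂ} {G' H' : MvPolynomial (Fin 2) ℂ}
    {s : ℂ} (hG : HasCoeffDerivAt G G' s) (hH : HasCoeffDerivAt H H' s) :
    HasCoeffDerivAt (fun t => G t * H t) (G' * H s + G s * H') s := by
  classical
  intro m
  simp only [coeff_add, coeff_mul, ← Finset.sum_add_distrib]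
  exact HasDerivAt.fun_sum fun x _ => (hG x.1).mul (hH x.2)

/-- `X j - t X k`, as a family of polynomials in `t`. -/
theorem hasCoeffDerivAt_X_sub (j k : Fin 2) (s : ℂ) :
    HasCoeffDerivAt (fun t => X j - C t * X k) (-X k) s := by
  intro m
  simp only [coeff_sub, coeff_C_mul, coeff_neg]
  simpa using ((hasDerivAt_id s).mul_const (coeff m (X k : MvPolynomial (Fin 2) ℂ))).const_sub
    (coeff m (X j : MvPolynomial (Fin 2) ℂ))

/-- The family of substitutions `X j ↦ X j - t X k`, with `X k` fixed, is generated by the vector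
field `-X k ∂/∂X j`. -/
theorem hasCoeffDerivAt_aeval {j k : Fin 2} (hjk : k ≠ j) {v : ℂ → Fin 2 → MvPolynomial (Fin 2) ℂ}
    (hj : ∀ t, v t j = X j - C t * X k) (hk : ∀ t, v t k = X k) (f : MvPolynomial (Fin 2) ℂ)
    (s : ℂ) :
    HasCoeffDerivAt (fun t => aeval (v t) f) (-(X k * pderiv j (aeval (v s) f))) s := by
  induction f using MvPolynomial.induction_on with
  | C r =>
    intro m
    simpa [algebraMap_eq] using hasDerivAt_const s (coeff m (C r : MvPolynomial (Fin 2) ℂ))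
  | add p q hp hq =>
    intro m
    simpa [mul_add, add_comm] using (hp m).fun_add (hq m)
  | mul_X p i hp =>
    simp only [map_mul, aeval_X, pderiv_mul]
    have hi : i = j ∨ i = k := by lia
    rcases hi with rfl | rfl
    · simp only [hj]
      convert hp.mul (hasCoeffDerivAt_X_sub i k s) using 1
      simp [pderiv_X_of_ne hjk]
      ring
    · simp only [hk]
      have hc : HasCoeffDerivAt (fun _ => X i) 0 s := fun m => by
        simpa using hasDerivAt_const s (coeff m (X i : MvPolynomial (Fin 2) ℂ))
      convert hp.mul hc using 1
      simp [pderiv_X_of_ne hjk]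
      ring

end Action

/-! ### Invariants as kernels of derivations -/

section InvariantsAsKernels

open MvPolynomial

theorem hasDerivAt_coeffAct_upper (d : ℕ) (a : Fin (d + 1) → ℂ) (s : ℂ) (i : Fin (d + 1)) :
    HasDerivAt (fun t => coeffAct d (upperUnipotent t) a i)
      ((if (i : ℕ) = 0 then 0 else -((d : ℂ) - (i : ℕ) + 1)) *
        coeffAct d (upperUnipotent s) a
          ⟨(i : ℕ) - 1, lt_of_le_of_lt (Nat.sub_le _ _) i.isLt⟩) s := by
  have h := hasCoeffDerivAt_aeval (j := 0) (k := 1) (by decide)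
    (v := fun t i => ∑ j : Fin 2, C ((upperUnipotent t)⁻¹.1 i j) * X j)
    (fun t => by simp [coe_upperUnipotent, Matrix.SpecialLinearGroup.coe_inv, sub_eq_add_neg])
    (fun t => by simp [coe_upperUnipotent, Matrix.SpecialLinearGroup.coe_inv]) (binaryForm d a) s
    (Finsupp.single (0 : Fin 2) (d - (i : ℕ)) + Finsupp.single (1 : Fin 2) (i : ℕ))
  refine h.congr_deriv ?_
  change coeff _ (-(X 1 * pderiv 0 (formAct (upperUnipotent s) (binaryForm d a)))) = _
  rw [coeff_neg, coeff_X_mul']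
  by_cases hi : (i : ℕ) = 0
  · simp [hi]
  · have hid := Nat.lt_succ_iff.1 i.2
    rw [if_pos (by simp [hi]), if_neg hi, coeff_pderiv, coeffAct]
    have hexp : Finsupp.single (0 : Fin 2) (d - (i : ℕ)) + Finsupp.single (1 : Fin 2) (i : ℕ) -
        Finsupp.single 1 1 + Finsupp.single 0 1 =
        Finsupp.single (0 : Fin 2) (d - ((i : ℕ) - 1)) +
          Finsupp.single (1 : Fin 2) ((i : ℕ) - 1) := by
      ext k
      fin_cases k <;> simp
      lia
    rw [hexp]
    have hc : (((Finsupp.single (0 : Fin 2) (d - (i : ℕ)) + Finsupp.single (1 : Fin 2) (i : ℕ) -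
        Finsupp.single 1 1 : Fin 2 →₀ ℕ) 0 : ℕ) : ℂ) = (d : ℂ) - (i : ℕ) := by
      simp [Nat.cast_sub hid]
    rw [hc]
    ring

theorem hasDerivAt_coeffAct_lower (d : ℕ) (a : Fin (d + 1) → ℂ) (s : ℂ) (i : Fin (d + 1)) :
    HasDerivAt (fun t => coeffAct d (lowerUnipotent t) a i)
      ((if (i : ℕ) = d then 0 else -(((i : ℕ) : ℂ) + 1)) *
        coeffAct d (lowerUnipotent s) a
          ⟨min ((i : ℕ) + 1) d, Nat.lt_succ_of_le (min_le_right _ _)⟩) s := by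
  have h := hasCoeffDerivAt_aeval (j := 1) (k := 0) (by decide)
    (v := fun t i => ∑ j : Fin 2, C ((lowerUnipotent t)⁻¹.1 i j) * X j)
    (fun t => by
      simp [coe_lowerUnipotent, Matrix.SpecialLinearGroup.coe_inv, sub_eq_add_neg, add_comm])
    (fun t => by simp [coe_lowerUnipotent, Matrix.SpecialLinearGroup.coe_inv]) (binaryForm d a) s
    (Finsupp.single (0 : Fin 2) (d - (i : ℕ)) + Finsupp.single (1 : Fin 2) (i : ℕ))
  refine h.congr_deriv ?_
  change coeff _ (-(X 0 * pderiv 1 (formAct (lowerUnipotent s) (binaryForm d a)))) = _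
  rw [coeff_neg, coeff_X_mul']
  have hid := Nat.lt_succ_iff.1 i.2
  by_cases hi : (i : ℕ) = d
  · simp [hi]
  · rw [if_pos (by simp; lia), if_neg hi, coeff_pderiv, coeffAct]
    have hexp : Finsupp.single (0 : Fin 2) (d - (i : ℕ)) + Finsupp.single (1 : Fin 2) (i : ℕ) -
        Finsupp.single 0 1 + Finsupp.single 1 1 =
        Finsupp.single (0 : Fin 2) (d - min ((i : ℕ) + 1) d) +
          Finsupp.single (1 : Fin 2) (min ((i : ℕ) + 1) d) := by
      ext k
      fin_cases k <;> simp <;> lia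
    rw [hexp]
    have hc : (((Finsupp.single (0 : Fin 2) (d - (i : ℕ)) + Finsupp.single (1 : Fin 2) (i : ℕ) -
        Finsupp.single 0 1 : Fin 2 →₀ ℕ) 1 : ℕ) : ℂ) = ((i : ℕ) : ℂ) := by
      simp
    rw [hc]
    ring

/-- The action of `SL₂` on pairs of binary forms, in coordinates. -/
noncomputable def pairAct (d₁ d₂ : ℕ) (g : Matrix.SpecialLinearGroup (Fin 2) ℂ)
    (x : FormIdx d₁ d₂ → ℂ) : FormIdx d₁ d₂ → ℂ :=
  Sum.elim (coeffAct d₁ g (x ∘ Sum.inl)) (coeffAct d₂ g (x ∘ Sum.inr))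

theorem pairAct_mul (d₁ d₂ : ℕ) (g h : Matrix.SpecialLinearGroup (Fin 2) ℂ)
    (x : FormIdx d₁ d₂ → ℂ) : pairAct d₁ d₂ (g * h) x = pairAct d₁ d₂ g (pairAct d₁ d₂ h x) := by
  simp only [pairAct, coeffAct_mul, Sum.elim_comp_inl, Sum.elim_comp_inr]

theorem pairAct_one (d₁ d₂ : ℕ) (x : FormIdx d₁ d₂ → ℂ) : pairAct d₁ d₂ 1 x = x := by
  simp only [pairAct, coeffAct_one, Sum.elim_comp_inl_inr]

theorem hasDerivAt_pairAct_upper (d₁ d₂ : ℕ) (x : FormIdx d₁ d₂ → ℂ) (s : ℂ) (i : FormIdx d₁ d₂) :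
    HasDerivAt (fun t => pairAct d₁ d₂ (upperUnipotent t) x i)
      (eval (pairAct d₁ d₂ (upperUnipotent s) x) (upperDerivation d₁ d₂ (X i))) s := by
  rcases i with i | i
  · refine (hasDerivAt_coeffAct_upper d₁ (x ∘ Sum.inl) s i).congr_deriv ?_
    simp only [upperDerivation, ladderUp, mkDerivation_X, Sum.elim_inl, smul_eval, eval_X]
    rfl
  · refine (hasDerivAt_coeffAct_upper d₂ (x ∘ Sum.inr) s i).congr_deriv ?_
    simp only [upperDerivation, ladderUp, mkDerivation_X, Sum.elim_inr, smul_eval, eval_X]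
    rfl

theorem hasDerivAt_pairAct_lower (d₁ d₂ : ℕ) (x : FormIdx d₁ d₂ → ℂ) (s : ℂ) (i : FormIdx d₁ d₂) :
    HasDerivAt (fun t => pairAct d₁ d₂ (lowerUnipotent t) x i)
      (eval (pairAct d₁ d₂ (lowerUnipotent s) x) (lowerDerivation d₁ d₂ (X i))) s := by
  rcases i with i | i
  · refine (hasDerivAt_coeffAct_lower d₁ (x ∘ Sum.inl) s i).congr_deriv ?_
    simp only [lowerDerivation, ladderDown, mkDerivation_X, Sum.elim_inl, smul_eval, eval_X]
    rfl
  · refine (hasDerivAt_coeffAct_lower d₂ (x ∘ Sum.inr) s i).congr_deriv ?_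
    simp only [lowerDerivation, ladderDown, mkDerivation_X, Sum.elim_inr, smul_eval, eval_X]
    rfl

theorem upperDerivation_eq_zero_iff {d₁ d₂ : ℕ} (P : MvPolynomial (FormIdx d₁ d₂) ℂ) :
    upperDerivation d₁ d₂ P = 0 ↔
      ∀ x t, eval (pairAct d₁ d₂ (upperUnipotent t) x) P = eval x P :=
  derivation_eq_zero_iff_eval_flow (γ := fun x t => pairAct d₁ d₂ (upperUnipotent t) x)
    (fun x => by rw [upperUnipotent_zero, pairAct_one]) (hasDerivAt_pairAct_upper d₁ d₂) P

theorem lowerDerivation_eq_zero_iff {d₁ d₂ : ℕ} (P : MvPolynomial (FormIdx d₁ d₂) ℂ) :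
    lowerDerivation d₁ d₂ P = 0 ↔
      ∀ x t, eval (pairAct d₁ d₂ (lowerUnipotent t) x) P = eval x P :=
  derivation_eq_zero_iff_eval_flow (γ := fun x t => pairAct d₁ d₂ (lowerUnipotent t) x)
    (fun x => by rw [lowerUnipotent_zero, pairAct_one]) (hasDerivAt_pairAct_lower d₁ d₂) P

theorem mem_jointInvariants_iff {d₁ d₂ : ℕ} {P : MvPolynomial (FormIdx d₁ d₂) ℂ} :
    P ∈ jointInvariants d₁ d₂ ↔ ∀ g x, eval (pairAct d₁ d₂ g x) P = eval x P := by
  refine ⟨fun h g x => ?_, fun h g a b => ?_⟩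
  · simpa only [pairAct, Sum.elim_comp_inl_inr] using h g (x ∘ Sum.inl) (x ∘ Sum.inr)
  · simpa only [pairAct, Sum.elim_comp_inl, Sum.elim_comp_inr] using h g (Sum.elim a b)

theorem mem_jointInvariants_iff_derivation {d₁ d₂ : ℕ} {P : MvPolynomial (FormIdx d₁ d₂) ℂ} :
    P ∈ jointInvariants d₁ d₂ ↔ upperDerivation d₁ d₂ P = 0 ∧ lowerDerivation d₁ d₂ P = 0 := by
  rw [mem_jointInvariants_iff, upperDerivation_eq_zero_iff, lowerDerivation_eq_zero_iff]
  refine ⟨fun h => ⟨fun x t => h _ x, fun x t => h _ x⟩, fun h g => ?_⟩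
  induction g using specialLinearGroup_induction with
  | hu s => exact fun x => h.1 x s
  | hl s => exact fun x => h.2 x s
  | hmul g g' hg hg' => exact fun x => by rw [pairAct_mul, hg, hg']

/-- The action of `SL₂` on `V_{d₁} ⊕ V_{d₂} ⊕ ℂ²`, in coordinates. -/
noncomputable def tripleAct (d₁ d₂ : ℕ) (g : Matrix.SpecialLinearGroup (Fin 2) ℂ)
    (x : FormIdx d₁ d₂ ⊕ Fin 2 → ℂ) : FormIdx d₁ d₂ ⊕ Fin 2 → ℂ :=
  Sum.elim (pairAct d₁ d₂ g (x ∘ Sum.inl)) (g.1.mulVec (x ∘ Sum.inr))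

theorem tripleAct_mul (d₁ d₂ : ℕ) (g h : Matrix.SpecialLinearGroup (Fin 2) ℂ)
    (x : FormIdx d₁ d₂ ⊕ Fin 2 → ℂ) :
    tripleAct d₁ d₂ (g * h) x = tripleAct d₁ d₂ g (tripleAct d₁ d₂ h x) := by
  simp only [tripleAct, pairAct_mul, Sum.elim_comp_inl, Sum.elim_comp_inr, Matrix.mulVec_mulVec,
    Matrix.SpecialLinearGroup.coe_mul]

theorem tripleAct_one (d₁ d₂ : ℕ) (x : FormIdx d₁ d₂ ⊕ Fin 2 → ℂ) : tripleAct d₁ d₂ 1 x = x := by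
  simp only [tripleAct, pairAct_one, Matrix.SpecialLinearGroup.coe_one, Matrix.one_mulVec,
    Sum.elim_comp_inl_inr]

theorem mem_jointCovariants_iff {d₁ d₂ : ℕ} {P : MvPolynomial (FormIdx d₁ d₂ ⊕ Fin 2) ℂ} :
    P ∈ jointCovariants d₁ d₂ ↔ ∀ g x, eval (tripleAct d₁ d₂ g x) P = eval x P := by
  refine ⟨fun h g x => ?_, fun h g a b v => ?_⟩
  · have := h g (x ∘ Sum.inl ∘ Sum.inl) (x ∘ Sum.inl ∘ Sum.inr) (x ∘ Sum.inr)
    rw [← Function.comp_assoc, ← Function.comp_assoc, Sum.elim_comp_inl_inr,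
      Sum.elim_comp_inl_inr] at this
    exact this
  · exact h g (Sum.elim (Sum.elim a b) v)

/-- The infinitesimal action of the upper triangular unipotent matrices on polynomial functions on
`V_{d₁} ⊕ V_{d₂} ⊕ ℂ²`. -/
noncomputable def covariantUpper (d₁ d₂ : ℕ) :
    Derivation ℂ (MvPolynomial (FormIdx d₁ d₂ ⊕ Fin 2) ℂ)
      (MvPolynomial (FormIdx d₁ d₂ ⊕ Fin 2) ℂ) :=
  mkDerivation ℂ (Sum.elim (fun i => rename Sum.inl (upperDerivation d₁ d₂ (X i)))
    ![X (Sum.inr 1), 0])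

/-- The infinitesimal action of the lower triangular unipotent matrices on polynomial functions on
`V_{d₁} ⊕ V_{d₂} ⊕ ℂ²`. -/
noncomputable def covariantLower (d₁ d₂ : ℕ) :
    Derivation ℂ (MvPolynomial (FormIdx d₁ d₂ ⊕ Fin 2) ℂ)
      (MvPolynomial (FormIdx d₁ d₂ ⊕ Fin 2) ℂ) :=
  mkDerivation ℂ (Sum.elim (fun i => rename Sum.inl (lowerDerivation d₁ d₂ (X i)))
    ![0, X (Sum.inr 0)])

theorem mem_jointCovariants_of_derivation {d₁ d₂ : ℕ} {P : MvPolynomial (FormIdx d₁ d₂ ⊕ Fin 2) ℂ}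
    (hu : covariantUpper d₁ d₂ P = 0) (hl : covariantLower d₁ d₂ P = 0) :
    P ∈ jointCovariants d₁ d₂ := by
  rw [derivation_eq_zero_iff_eval_flow
    (γ := fun x t => tripleAct d₁ d₂ (upperUnipotent t) x)
    (fun x => by rw [upperUnipotent_zero, tripleAct_one])] at hu
  rotate_left
  · rintro x s (i | i)
    · simpa [tripleAct, covariantUpper, mkDerivation_X, eval_rename] using
        hasDerivAt_pairAct_upper d₁ d₂ (x ∘ Sum.inl) s i
    · fin_cases i
      · simpa [tripleAct, covariantUpper, mkDerivation_X, coe_upperUnipotent, Matrix.mulVec,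
          dotProduct, Fin.sum_univ_two] using
          ((hasDerivAt_id s).mul_const (x (Sum.inr 1))).const_add (x (Sum.inr 0))
      · simpa [tripleAct, covariantUpper, mkDerivation_X, coe_upperUnipotent, Matrix.mulVec,
          dotProduct, Fin.sum_univ_two] using hasDerivAt_const s (x (Sum.inr 1))
  rw [derivation_eq_zero_iff_eval_flow
    (γ := fun x t => tripleAct d₁ d₂ (lowerUnipotent t) x)
    (fun x => by rw [lowerUnipotent_zero, tripleAct_one])] at hl
  rotate_left
  · rintro x s (i | i)
    · simpa [tripleAct, covariantLower, mkDerivation_X, eval_rename] using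
        hasDerivAt_pairAct_lower d₁ d₂ (x ∘ Sum.inl) s i
    · fin_cases i
      · simpa [tripleAct, covariantLower, mkDerivation_X, coe_lowerUnipotent, Matrix.mulVec,
          dotProduct, Fin.sum_univ_two] using hasDerivAt_const s (x (Sum.inr 0))
      · simpa [tripleAct, covariantLower, mkDerivation_X, coe_lowerUnipotent, Matrix.mulVec,
          dotProduct, Fin.sum_univ_two] using
          ((hasDerivAt_id s).mul_const (x (Sum.inr 0))).add_const (x (Sum.inr 1))
  rw [mem_jointCovariants_iff]
  intro g
  induction g using specialLinearGroup_induction with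
  | hu s => exact fun x => hu x s
  | hl s => exact fun x => hl x s
  | hmul g g' hg hg' => exact fun x => by rw [tripleAct_mul, hg, hg']

end InvariantsAsKernels

/-! ### Covariants and semi-invariants -/

section Covariants

open MvPolynomial

namespace IsSl2Pair

variable {σ : Type*} {wt : σ → ℤ} {e f : Derivation ℂ (MvPolynomial σ ℂ) (MvPolynomial σ ℂ)}

theorem lower_iterate_mem (h : IsSl2Pair wt e f) {n : ℕ} {μ : ℤ} {u : MvPolynomial σ ℂ}
    (hu : u ∈ weightSpan wt n {μ}) (j : ℕ) : f^[j] u ∈ weightSpan wt n {μ - 2 * j} := by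
  induction j with
  | zero => simpa using hu
  | succ j ih =>
    rw [Function.iterate_succ_apply']
    have := h.lower_mem ih
    convert this using 3
    push_cast
    ring

theorem raise_lower_iterate (h : IsSl2Pair wt e f) {n : ℕ} {μ : ℤ} {u : MvPolynomial σ ℂ}
    (hu : u ∈ weightSpan wt n {μ}) (he : e u = 0) (j : ℕ) :
    e (f^[j + 1] u) = (((j : ℂ) + 1) * (μ - j)) • f^[j] u := by
  induction j with
  | zero => simpa [he] using h.comm hu
  | succ j ih =>
    have hc := h.comm (h.lower_iterate_mem hu (j + 1))
    rw [ih, Derivation.map_smul, ← Function.iterate_succ_apply' f j u,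
      ← Function.iterate_succ_apply' f (j + 1) u, sub_eq_iff_eq_add, ← add_smul] at hc
    rw [hc]
    congr 1
    push_cast
    ring

/-- A highest weight vector of weight `m` generates a module of dimension at most `m + 1`. -/
theorem lower_iterate_eq_zero [Finite σ] (h : IsSl2Pair wt e f) {n m : ℕ} {u : MvPolynomial σ ℂ}
    (hu : u ∈ weightSpan wt n {(m : ℤ)}) (he : e u = 0) : f^[m + 1] u = 0 := by
  refine h.raise_injective ?_ (h.lower_iterate_mem hu (m + 1)) ?_
  · push_cast
    lia
  · rw [h.raise_lower_iterate hu he]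
    simp

end IsSl2Pair

theorem isWeightedHomogeneous_aeval {σ τ : Type*} {w : σ → ℕ} {w' : τ → ℕ}
    {v : σ → MvPolynomial τ ℂ} (hv : ∀ i, IsWeightedHomogeneous w' (v i) (w i))
    {P : MvPolynomial σ ℂ} {n : ℕ} (hP : IsWeightedHomogeneous w P n) :
    IsWeightedHomogeneous w' (aeval v P) n := by
  rw [P.as_sum, map_sum]
  refine IsWeightedHomogeneous.sum _ _ _ fun s hs => ?_
  rw [aeval_monomial, ← hP (mem_support_iff.1 hs), algebraMap_eq]
  refine IsWeightedHomogeneous.C_mul ?_ _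
  rw [Finsupp.weight_apply]
  exact IsWeightedHomogeneous.prod _ _ _ fun i _ => (hv i).pow (s i)

theorem derivation_rename_inl {σ τ : Type*}
    {D : Derivation ℂ (MvPolynomial σ ℂ) (MvPolynomial σ ℂ)}
    {D' : Derivation ℂ (MvPolynomial (σ ⊕ τ) ℂ) (MvPolynomial (σ ⊕ τ) ℂ)}
    (h : ∀ i, D' (X (Sum.inl i)) = rename Sum.inl (D (X i))) (q : MvPolynomial σ ℂ) :
    D' (rename Sum.inl q) = rename Sum.inl (D q) := by
  induction q using MvPolynomial.induction_on with
  | C r => simp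
  | add p q hp hq => simp [hp, hq]
  | mul_X p i hp => simp [hp, h, Derivation.leibniz]

/-- The leading coefficient of a covariant: its restriction to the vector `(1, 0)` of `ℂ²`. -/
noncomputable def leadingCoefficient (d₁ d₂ : ℕ) :
    MvPolynomial (FormIdx d₁ d₂ ⊕ Fin 2) ℂ →ₐ[ℂ] MvPolynomial (FormIdx d₁ d₂) ℂ :=
  aeval (Sum.elim X ![1, 0])

theorem eval_leadingCoefficient {d₁ d₂ : ℕ} (P : MvPolynomial (FormIdx d₁ d₂ ⊕ Fin 2) ℂ)
    (x : FormIdx d₁ d₂ → ℂ) :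
    eval x (leadingCoefficient d₁ d₂ P) = eval (Sum.elim x ![1, 0]) P := by
  rw [← aeval_eq_eval, ← aeval_eq_eval, leadingCoefficient]
  simp only [comp_aeval_apply]
  refine congrArg (fun v => aeval v P) (funext fun i => ?_)
  rcases i with i | i
  · simp
  · fin_cases i <;> simp

/-- The leading coefficient determines a covariant because `SL₂` acts transitively on
`ℂ² \ {0}`. -/
theorem eq_zero_of_leadingCoefficient_eq_zero {d₁ d₂ : ℕ}
    {P : MvPolynomial (FormIdx d₁ d₂ ⊕ Fin 2) ℂ} (hP : P ∈ jointCovariants d₁ d₂)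
    (h0 : leadingCoefficient d₁ d₂ P = 0) : P = 0 := by
  rw [mem_jointCovariants_iff] at hP
  have key : P * X (Sum.inr 0) = 0 := by
    refine MvPolynomial.funext fun x => ?_
    rw [map_mul, eval_X, map_zero]
    by_cases hx : x (Sum.inr 0) = 0
    · rw [hx, mul_zero]
    · let g : Matrix.SpecialLinearGroup (Fin 2) ℂ :=
        ⟨!![x (Sum.inr 0), 0; x (Sum.inr 1), (x (Sum.inr 0))⁻¹], by simp [hx]⟩
      have hg : tripleAct d₁ d₂ g (Sum.elim (pairAct d₁ d₂ g⁻¹ (x ∘ Sum.inl)) ![1, 0]) = x := by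
        rw [tripleAct, Sum.elim_comp_inl, ← pairAct_mul, mul_inv_cancel, pairAct_one]
        funext i
        rcases i with i | i
        · rfl
        · fin_cases i <;> simp [g]
      rw [← hg, hP, ← eval_leadingCoefficient, h0, map_zero, zero_mul]
  exact (mul_eq_zero.1 key).resolve_right (X_ne_zero _)

theorem upperDerivation_leadingCoefficient {d₁ d₂ : ℕ}
    {P : MvPolynomial (FormIdx d₁ d₂ ⊕ Fin 2) ℂ} (hP : P ∈ jointCovariants d₁ d₂) :
    upperDerivation d₁ d₂ (leadingCoefficient d₁ d₂ P) = 0 := by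
  rw [mem_jointCovariants_iff] at hP
  rw [upperDerivation_eq_zero_iff]
  intro x t
  rw [eval_leadingCoefficient, eval_leadingCoefficient, ← hP (upperUnipotent t) (Sum.elim x _)]
  congr 2
  rw [tripleAct, Sum.elim_comp_inl, Sum.elim_comp_inr, coe_upperUnipotent]
  congr 1
  funext i
  fin_cases i <;> simp [Matrix.mulVec, dotProduct, Fin.sum_univ_two]

/-- The covariant `∑ⱼ (-1)ʲ / j! · Fʲ u · x^(m-j) yʲ` with leading coefficient `u`, where `F` is
the lowering operator and `m` the weight of `u`. -/
noncomputable def covariantOfSemiInvariant (d₁ d₂ m : ℕ) (u : MvPolynomial (FormIdx d₁ d₂) ℂ) :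
    MvPolynomial (FormIdx d₁ d₂ ⊕ Fin 2) ℂ :=
  ∑ j ∈ Finset.range (m + 1), ((-1 : ℂ) ^ j / (j.factorial : ℂ)) •
    (rename Sum.inl ((lowerDerivation d₁ d₂)^[j] u) *
      (X (Sum.inr 0) ^ (m - j) * X (Sum.inr 1) ^ j))

theorem leadingCoefficient_covariantOfSemiInvariant (d₁ d₂ m : ℕ)
    (u : MvPolynomial (FormIdx d₁ d₂) ℂ) :
    leadingCoefficient d₁ d₂ (covariantOfSemiInvariant d₁ d₂ m u) = u := by
  rw [covariantOfSemiInvariant, map_sum, Finset.sum_eq_single 0]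
  · have h : leadingCoefficient d₁ d₂ (rename Sum.inl u) = u := by
      rw [leadingCoefficient, aeval_rename, Sum.elim_comp_inl, aeval_X_left, AlgHom.id_apply]
    simp only [pow_zero, Nat.factorial_zero, Nat.cast_one, div_one, one_smul,
      Function.iterate_zero, id_eq, Nat.sub_zero, mul_one, map_mul, map_pow, h]
    simp [leadingCoefficient]
  · intro j _ hj
    simp [leadingCoefficient, hj]
  · simp

theorem covariantOfSemiInvariant_mem {d₁ d₂ n m : ℕ} {u : MvPolynomial (FormIdx d₁ d₂) ℂ}
    (hu : u ∈ weightSpan (formWeight d₁ d₂) n {(m : ℤ)}) (he : upperDerivation d₁ d₂ u = 0) :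
    covariantOfSemiInvariant d₁ d₂ m u ∈ covariantsOfDegree d₁ d₂ n := by
  have hpair := isSl2Pair_upper_lower d₁ d₂
  have hfac (k : ℕ) : ((-1 : ℂ) ^ (k + 1) / ((k + 1).factorial : ℂ)) * (k + 1) =
      -((-1 : ℂ) ^ k / (k.factorial : ℂ)) := by
    have h1 : (k.factorial : ℂ) ≠ 0 := by exact_mod_cast k.factorial_ne_zero
    have h2 : (k : ℂ) + 1 ≠ 0 := by exact_mod_cast k.succ_ne_zero
    rw [Nat.factorial_succ]
    push_cast
    field_simp
    ring
  refine ⟨mem_jointCovariants_of_derivation ?_ ?_, ?_⟩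
  · -- the sums telescope; the last boundary term has the coefficient `m - m`
    have key (k : ℕ) (hk : k ≤ m) : ∑ j ∈ Finset.range (k + 1), covariantUpper d₁ d₂
        (((-1 : ℂ) ^ j / (j.factorial : ℂ)) •
          (rename Sum.inl ((lowerDerivation d₁ d₂)^[j] u) *
            (X (Sum.inr 0) ^ (m - j) * X (Sum.inr 1) ^ j))) =
        (((-1 : ℂ) ^ k / (k.factorial : ℂ)) * ((m - k : ℕ) : ℂ)) •
          (rename Sum.inl ((lowerDerivation d₁ d₂)^[k] u) *
            (X (Sum.inr 0) ^ (m - k - 1) * X (Sum.inr 1) ^ (k + 1))) := by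
      have hterm (q : MvPolynomial (FormIdx d₁ d₂) ℂ) (a b : ℕ) : covariantUpper d₁ d₂
          (rename Sum.inl q * (X (Sum.inr 0) ^ a * X (Sum.inr 1) ^ b)) =
          rename Sum.inl (upperDerivation d₁ d₂ q) * (X (Sum.inr 0) ^ a * X (Sum.inr 1) ^ b) +
            (a : ℂ) • (rename Sum.inl q * (X (Sum.inr 0) ^ (a - 1) * X (Sum.inr 1) ^ (b + 1))) := by
        have hr := derivation_rename_inl (D := upperDerivation d₁ d₂) (D' := covariantUpper d₁ d₂)
          (fun i => by simp [covariantUpper, mkDerivation_X]) q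
        have hx : covariantUpper d₁ d₂ (X (Sum.inr 0)) = X (Sum.inr 1) := by
          simp [covariantUpper, mkDerivation_X]
        have hy : covariantUpper d₁ d₂ (X (Sum.inr 1)) = 0 := by
          simp [covariantUpper, mkDerivation_X]
        simp only [Derivation.leibniz, Derivation.leibniz_pow, hr, hx, hy, smul_eq_mul,
          nsmul_eq_mul, Nat.cast_smul_eq_nsmul]
        ring
      induction k with
      | zero => simp [hterm, he]
      | succ k ih =>
        rw [Finset.sum_range_succ, ih (by lia), Derivation.map_smul, hterm,
          hpair.raise_lower_iterate hu he, map_smul, smul_mul_assoc, smul_add, smul_smul, smul_smul]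
        have hc : (-1 : ℂ) ^ (k + 1) / ((k + 1).factorial : ℂ) *
            (((k : ℂ) + 1) * (((m : ℤ) : ℂ) - k)) =
            -((-1 : ℂ) ^ k / (k.factorial : ℂ) * ((m - k : ℕ) : ℂ)) := by
          rw [← mul_assoc, hfac, Nat.cast_sub (by lia)]
          push_cast
          ring
        rw [hc, neg_smul, ← add_assoc, Nat.sub_sub, add_neg_cancel, zero_add]
    rw [covariantOfSemiInvariant, map_sum, key m le_rfl]
    simp
  · -- the sums telescope; the last boundary term contains `F^(m+1) u = 0`
    have key (k : ℕ) (hk : k ≤ m) : ∑ j ∈ Finset.range (k + 1), covariantLower d₁ d₂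
        (((-1 : ℂ) ^ j / (j.factorial : ℂ)) •
          (rename Sum.inl ((lowerDerivation d₁ d₂)^[j] u) *
            (X (Sum.inr 0) ^ (m - j) * X (Sum.inr 1) ^ j))) =
        ((-1 : ℂ) ^ k / (k.factorial : ℂ)) •
          (rename Sum.inl ((lowerDerivation d₁ d₂)^[k + 1] u) *
            (X (Sum.inr 0) ^ (m - k) * X (Sum.inr 1) ^ k)) := by
      have hterm (q : MvPolynomial (FormIdx d₁ d₂) ℂ) (a b : ℕ) : covariantLower d₁ d₂
          (rename Sum.inl q * (X (Sum.inr 0) ^ a * X (Sum.inr 1) ^ b)) =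
          rename Sum.inl (lowerDerivation d₁ d₂ q) * (X (Sum.inr 0) ^ a * X (Sum.inr 1) ^ b) +
            (b : ℂ) • (rename Sum.inl q * (X (Sum.inr 0) ^ (a + 1) * X (Sum.inr 1) ^ (b - 1))) := by
        have hr := derivation_rename_inl (D := lowerDerivation d₁ d₂) (D' := covariantLower d₁ d₂)
          (fun i => by simp [covariantLower, mkDerivation_X]) q
        have hx : covariantLower d₁ d₂ (X (Sum.inr 0)) = 0 := by
          simp [covariantLower, mkDerivation_X]
        have hy : covariantLower d₁ d₂ (X (Sum.inr 1)) = X (Sum.inr 0) := by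
          simp [covariantLower, mkDerivation_X]
        simp only [Derivation.leibniz, Derivation.leibniz_pow, hr, hx, hy, smul_eq_mul,
          nsmul_eq_mul, Nat.cast_smul_eq_nsmul]
        ring
      induction k with
      | zero => simp [hterm]
      | succ k ih =>
        rw [Finset.sum_range_succ, ih (by lia), Derivation.map_smul, hterm,
          ← Function.iterate_succ_apply' (lowerDerivation d₁ d₂) (k + 1) u, smul_add, smul_smul,
          Nat.cast_succ, hfac, neg_smul, Nat.add_sub_cancel, show m - (k + 1) + 1 = m - k by lia]
        abel
    rw [covariantOfSemiInvariant, map_sum, key m le_rfl, hpair.lower_iterate_eq_zero hu he]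
    simp
  · refine Submodule.sum_mem _ fun j _ => Submodule.smul_mem _ _ ?_
    rw [mem_weightedHomogeneousSubmodule, ← add_zero n]
    set w : FormIdx d₁ d₂ ⊕ Fin 2 → ℕ := Sum.elim (fun _ => 1) (fun _ => 0)
    have hw (i : Fin 2) : IsWeightedHomogeneous w (X (Sum.inr i) : MvPolynomial _ ℂ) 0 :=
      isWeightedHomogeneous_X ℂ w (Sum.inr i)
    refine IsWeightedHomogeneous.mul ?_ ?_
    · have h1 := weightSpan_mono (Set.subset_univ _) (hpair.lower_iterate_mem hu j)
      rw [weightSpan_univ] at h1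
      rw [rename_eq_aeval]
      exact isWeightedHomogeneous_aeval (w := 1) (v := X ∘ Sum.inl) (w' := w)
        (fun i => isWeightedHomogeneous_X ℂ w (Sum.inl i)) h1
    · simpa only [smul_zero, add_zero] using ((hw 0).pow (m - j)).mul ((hw 1).pow j)

/-- Restriction to `(1, 0)` identifies covariants with semi-invariants. -/
noncomputable def covariantsEquiv (d₁ d₂ n : ℕ) : covariantsOfDegree d₁ d₂ n ≃ₗ[ℂ]
    (LinearMap.ker (upperDerivation d₁ d₂).toLinearMap ⊓
      homogeneousSubmodule (FormIdx d₁ d₂) ℂ n : Submodule ℂ (MvPolynomial (FormIdx d₁ d₂) ℂ)) := by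
  have hmem : ∀ P ∈ covariantsOfDegree d₁ d₂ n, (leadingCoefficient d₁ d₂).toLinearMap P ∈
      (LinearMap.ker (upperDerivation d₁ d₂).toLinearMap ⊓
        homogeneousSubmodule (FormIdx d₁ d₂) ℂ n :
          Submodule ℂ (MvPolynomial (FormIdx d₁ d₂) ℂ)) := by
    refine fun P hP => ⟨upperDerivation_leadingCoefficient hP.1, ?_⟩
    refine isWeightedHomogeneous_aeval (w' := 1) (fun i => ?_) hP.2
    rcases i with i | i
    · exact isWeightedHomogeneous_X _ _ _
    · fin_cases i
      · exact isWeightedHomogeneous_one _ _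
      · exact isWeightedHomogeneous_zero _ _ _
  refine LinearEquiv.ofBijective ((leadingCoefficient d₁ d₂).toLinearMap.restrict hmem) ⟨?_, ?_⟩
  · rw [← LinearMap.ker_eq_bot, LinearMap.ker_eq_bot']
    rintro ⟨P, hP⟩ h
    exact Subtype.ext (eq_zero_of_leadingCoefficient_eq_zero hP.1 (congrArg Subtype.val h))
  · rintro ⟨u, hu, hun⟩
    rw [← weightSpan_univ (formWeight d₁ d₂)] at hun
    obtain ⟨P, hP, hPu⟩ := (isSl2Pair_upper_lower d₁ d₂).ker_raise_le
      (V := (covariantsOfDegree d₁ d₂ n).map (leadingCoefficient d₁ d₂).toLinearMap)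
      (fun μ hμ u hu he => by
        lift μ to ℕ using hμ
        exact ⟨_, covariantOfSemiInvariant_mem hu he,
          leadingCoefficient_covariantOfSemiInvariant d₁ d₂ μ u⟩) hun hu
    exact ⟨⟨P, hP⟩, Subtype.ext hPu⟩

/-! ### Dimension formulas -/

instance finiteDimensional_homogeneousSubmodule {σ : Type*} [Finite σ] (n : ℕ) :
    FiniteDimensional ℂ (homogeneousSubmodule σ ℂ n) :=
  Module.Finite.iff_fg.2 (homogeneousSubmodule_fg σ ℂ n)

theorem finiteDimensional_invariantsOfDegree (d₁ d₂ n : ℕ) :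
    FiniteDimensional ℂ (invariantsOfDegree d₁ d₂ n) :=
  Submodule.finiteDimensional_of_le inf_le_right

theorem finiteDimensional_semiInvariantsOfDegree (d₁ d₂ n : ℕ) :
    FiniteDimensional ℂ (semiInvariantsOfDegree d₁ d₂ n) :=
  Submodule.finiteDimensional_of_le inf_le_right

theorem finiteDimensional_covariantsOfDegree (d₁ d₂ n : ℕ) :
    FiniteDimensional ℂ (covariantsOfDegree d₁ d₂ n) :=
  have := Submodule.finiteDimensional_of_le (S₂ := homogeneousSubmodule (FormIdx d₁ d₂) ℂ n)
    (inf_le_right : LinearMap.ker (upperDerivation d₁ d₂).toLinearMap ⊓ _ ≤ _)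
  (covariantsEquiv d₁ d₂ n).symm.finiteDimensional

theorem finrank_invariantsOfDegree (d₁ d₂ n : ℕ) :
    Module.finrank ℂ (invariantsOfDegree d₁ d₂ n) + (exponentSet (formWeight d₁ d₂) n {2}).ncard =
      (exponentSet (formWeight d₁ d₂) n {0}).ncard := by
  rw [← (isSl2Pair_upper_lower d₁ d₂).finrank_ker_raise_ker_lower n]
  have h : invariantsOfDegree d₁ d₂ n = LinearMap.ker (upperDerivation d₁ d₂).toLinearMap ⊓
      LinearMap.ker (lowerDerivation d₁ d₂).toLinearMap ⊓
        homogeneousSubmodule (FormIdx d₁ d₂) ℂ n := by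
    ext P
    exact and_congr_left' mem_jointInvariants_iff_derivation
  rw [h]

theorem finrank_semiInvariantsOfDegree (d₁ d₂ n : ℕ) :
    Module.finrank ℂ (semiInvariantsOfDegree d₁ d₂ n) =
      (exponentSet (formWeight d₁ d₂) n {0}).ncard +
        (exponentSet (formWeight d₁ d₂) n {1}).ncard :=
  (isSl2Pair_raisingDerivation d₁ d₂).finrank_ker_raise n

theorem finrank_covariantsOfDegree (d₁ d₂ n : ℕ) :
    Module.finrank ℂ (covariantsOfDegree d₁ d₂ n) =
      (exponentSet (formWeight d₁ d₂) n {0}).ncard +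
        (exponentSet (formWeight d₁ d₂) n {1}).ncard := by
  rw [(covariantsEquiv d₁ d₂ n).finrank_eq]
  exact (isSl2Pair_upper_lower d₁ d₂).finrank_ker_raise n

end Covariants

/-! ### Partial fractions with double poles -/

section PartialFractions

open Polynomial in
/-- Here `ε = 1 - xⱼ T`; modulo `ε²` only the linear terms of the product survive. -/
theorem sq_dvd_prod_one_add_mul_sub {R ι : Type*} [CommRing R] (s : Finset ι) (c : ι → R) (ε : R) :
    ε ^ 2 ∣ ∏ i ∈ s, (1 + c i * ε) ^ 2 - (1 + 2 * (∑ i ∈ s, c i) * ε) := by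
  classical
  induction s using Finset.induction_on with
  | empty => simp
  | insert a s ha ih =>
    obtain ⟨q, hq⟩ := ih
    rw [sub_eq_iff_eq_add] at hq
    rw [Finset.prod_insert ha, Finset.sum_insert ha, hq]
    exact ⟨(1 + c a * ε) ^ 2 * q + c a ^ 2 * (1 + 2 * (∑ i ∈ s, c i) * ε) +
      4 * c a * ∑ i ∈ s, c i, by ring⟩

open Polynomial in
/-- The partial fraction expansion of `∏ (1 - xᵢ T)⁻²`, with denominators cleared. The element
`g i j` is `1 / (1 - xᵢ / xⱼ)`; no other division is needed, so the identity holds in every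
domain. -/
theorem sum_doublePole_mul_prod {R ι : Type*} [CommRing R] [IsDomain R] [DecidableEq ι]
    {s : Finset ι} (hs : s.Nonempty) {x : ι → R} (hx : ∀ i ∈ s, x i ≠ 0) {g : ι → ι → R}
    (hg : ∀ j ∈ s, ∀ i ∈ s, i ≠ j → g i j * (x j - x i) = x j) :
    ∑ j ∈ s, (C (2 * (∏ i ∈ s.erase j, g i j ^ 2) * ∑ i ∈ s.erase j, (1 - g i j)) *
        (1 - C (x j) * X) + C (∏ i ∈ s.erase j, g i j ^ 2)) *
          ∏ i ∈ s.erase j, (1 - C (x i) * X) ^ 2 = 1 := by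
  set ε : ι → R[X] := fun i => 1 - C (x i) * X with hε
  set Q := ∑ j ∈ s, (C (2 * (∏ i ∈ s.erase j, g i j ^ 2) * ∑ i ∈ s.erase j, (1 - g i j)) *
        ε j + C (∏ i ∈ s.erase j, g i j ^ 2)) * ∏ i ∈ s.erase j, ε i ^ 2 with hQ
  -- `xᵢ g i j = xⱼ (g i j - 1)`
  have hlin {i j : ι} (hj : j ∈ s) (hi : i ∈ s) (hij : i ≠ j) :
      C (g i j) * ε i = 1 + C (g i j - 1) * ε j := by
    have h := congrArg (C : R →+* R[X]) (hg j hj i hi hij)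
    simp only [map_mul, map_sub, map_one, hε] at h ⊢
    linear_combination X * h
  have hcop : (s : Set ι).Pairwise (Function.onFun IsCoprime fun i => ε i ^ 2) := by
    intro i hi j hj hij
    refine IsCoprime.pow ⟨C (g i j), -C (g i j - 1), ?_⟩
    rw [hlin hj hi hij]
    ring
  have hdvd (j : ι) (hj : j ∈ s) : ε j ^ 2 ∣ Q - 1 := by
    rw [hQ, ← Finset.add_sum_erase s _ hj, add_sub_right_comm]
    refine dvd_add ?_ (Finset.dvd_sum fun i hi => Dvd.dvd.mul_left
      (Finset.dvd_prod_of_mem (fun i => ε i ^ 2) (Finset.mem_erase.2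
        ⟨(Finset.ne_of_mem_erase hi).symm, hj⟩)) _)
    obtain ⟨q, hq⟩ := sq_dvd_prod_one_add_mul_sub (s.erase j) (fun i => C (g i j - 1)) (ε j)
    have hprod : C (∏ i ∈ s.erase j, g i j ^ 2) * ∏ i ∈ s.erase j, ε i ^ 2 =
        ∏ i ∈ s.erase j, (1 + C (g i j - 1) * ε j) ^ 2 := by
      rw [map_prod, ← Finset.prod_mul_distrib]
      refine Finset.prod_congr rfl fun i hi => ?_
      rw [← hlin hj (Finset.mem_of_mem_erase hi) (Finset.ne_of_mem_erase hi), map_pow, mul_pow]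
    rw [sub_eq_iff_eq_add, ← hprod, ← map_sum] at hq
    have hsum : ∑ i ∈ s.erase j, (g i j - 1) = -∑ i ∈ s.erase j, (1 - g i j) := by
      rw [← Finset.sum_neg_distrib]
      exact Finset.sum_congr rfl fun i _ => (neg_sub _ _).symm
    rw [hsum] at hq
    set σ := ∑ i ∈ s.erase j, (1 - g i j)
    set B := ∏ i ∈ s.erase j, g i j ^ 2
    refine ⟨q + 2 * C σ * ε j * q - 4 * C σ ^ 2, ?_⟩
    simp only [map_mul, map_neg, map_ofNat] at hq ⊢
    linear_combination (2 * C σ * ε j + 1) * hq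
  have hdvd' : ∏ j ∈ s, ε j ^ 2 ∣ Q - 1 := Finset.prod_dvd_of_coprime hcop hdvd
  have hdegε (i : ι) : (ε i).natDegree ≤ 1 := by
    refine (natDegree_sub_le _ _).trans ?_
    simpa using natDegree_C_mul_X_pow_le (x i) 1
  have hdeg : (Q - 1).natDegree < (∏ j ∈ s, ε j ^ 2).natDegree := by
    have h1 : (∏ j ∈ s, ε j ^ 2).natDegree = ∑ j ∈ s, 2 := by
      have hε1 (i : ι) (hi : i ∈ s) : (ε i).natDegree = 1 := by
        refine natDegree_eq_of_degree_eq_some ?_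
        change (1 - C (x i) * X).degree = _
        rw [sub_eq_neg_add, degree_add_eq_left_of_degree_lt] <;>
          rw [degree_neg, ← pow_one X, degree_C_mul_X_pow 1 (hx i hi)]
        rw [degree_one]
        exact Nat.cast_lt.2 zero_lt_one
      rw [natDegree_prod _ _ fun i hi h0 => ?_]
      · exact Finset.sum_congr rfl fun i hi => by rw [natDegree_pow, hε1 i hi]
      · have := hε1 i hi
        rw [pow_eq_zero_iff two_ne_zero] at h0
        rw [h0] at this
        simp at this
    have h2 : (Q - 1).natDegree ≤ 1 + 2 * (s.card - 1) := by
      refine (natDegree_sub_le _ _).trans (max_le (natDegree_sum_le_of_forall_le _ _ fun j hj => ?_)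
        (by simp))
      refine natDegree_mul_le_of_le ?_ ?_
      · refine natDegree_add_le_of_degree_le ((natDegree_C_mul_le _ _).trans (hdegε j))
          ((natDegree_C _).trans_le zero_le_one)
      · refine (natDegree_prod_le _ _).trans ?_
        rw [← Finset.card_erase_of_mem hj, mul_comm, ← smul_eq_mul]
        refine Finset.sum_le_card_nsmul _ _ _ fun i _ => ?_
        exact natDegree_pow_le_of_le 2 (hdegε i)
    rw [h1, Finset.sum_const, smul_eq_mul]
    have := hs.card_pos
    lia
  exact sub_eq_zero.1 (eq_zero_of_dvd_of_natDegree_lt hdvd' hdeg)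

open PowerSeries in
theorem mk_pow_mul_one_sub {R : Type*} [CommRing R] (x : R) :
    (mk fun n => x ^ n) * (1 - C x * X) = 1 := by
  ext n
  rcases n with _ | n
  · simp
  · rw [mul_sub, mul_one, map_sub, ← mul_assoc, coeff_succ_mul_X, coeff_mul_C, coeff_mk, coeff_mk,
      coeff_one, if_neg n.succ_ne_zero, pow_succ, sub_self]

open PowerSeries in
theorem coeff_mk_pow_sq {R : Type*} [CommRing R] (x : R) (n : ℕ) :
    coeff n ((mk fun n => x ^ n) ^ 2) = (n + 1) * x ^ n := by
  rw [sq, coeff_mul]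
  simp only [coeff_mk]
  rw [Finset.sum_congr rfl fun p hp => by
    rw [← pow_add, Finset.HasAntidiagonal.mem_antidiagonal.1 hp]]
  simp

open PowerSeries in
theorem coeff_prod_mk_pow_sq_of_sum_eq_one {R ι : Type*} [CommRing R] [DecidableEq ι]
    {s : Finset ι} {x A B : ι → R}
    (h : ∑ j ∈ s, (Polynomial.C (A j) * (1 - Polynomial.C (x j) * Polynomial.X) +
      Polynomial.C (B j)) * ∏ i ∈ s.erase j, (1 - Polynomial.C (x i) * Polynomial.X) ^ 2 = 1)
    (n : ℕ) :
    coeff n (∏ i ∈ s, (mk fun n => x i ^ n) ^ 2) = ∑ j ∈ s, (A j + (n + 1) * B j) * x j ^ n := by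
  have key := congrArg (Polynomial.coeToPowerSeries.ringHom (R := R)) h
  simp only [map_sum, map_mul, map_add, map_sub, map_one, map_prod, map_pow,
    Polynomial.coeToPowerSeries.ringHom_apply, Polynomial.coe_C, Polynomial.coe_X] at key
  rw [← mul_one (∏ i ∈ s, _), ← key, Finset.mul_sum, map_sum]
  refine Finset.sum_congr rfl fun j hj => ?_
  have hcancel : (∏ i ∈ s.erase j, (mk fun n => x i ^ n) ^ 2) *
      ∏ i ∈ s.erase j, (1 - C (x i) * X) ^ 2 = 1 := by
    rw [← Finset.prod_mul_distrib]
    exact Finset.prod_eq_one fun i _ => by rw [← mul_pow, mk_pow_mul_one_sub, one_pow]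
  have hj1 := mk_pow_mul_one_sub (x j)
  have hj2 := coeff_mk_pow_sq (x j) n
  have hj3 : coeff n (mk fun n => x j ^ n) = x j ^ n := coeff_mk _ _
  rw [← Finset.mul_prod_erase s _ hj]
  set G : R⟦X⟧ := mk fun n => x j ^ n
  have hre : G ^ 2 * (∏ i ∈ s.erase j, (mk fun n => x i ^ n) ^ 2) *
      ((C (A j) * (1 - C (x j) * X) + C (B j)) * ∏ i ∈ s.erase j, (1 - C (x i) * X) ^ 2) =
      C (A j) * G + C (B j) * G ^ 2 := by
    linear_combination (C (A j) * (1 - C (x j) * X) + C (B j)) * G ^ 2 * hcancel +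
      C (A j) * G * hj1
  rw [hre, map_add, coeff_C_mul, coeff_C_mul, hj2, hj3]
  ring

/-- The partial fraction expansion of `∏ (1 - xᵢ T)⁻²`, read off coefficientwise. -/
theorem coeff_prod_mk_pow_sq {R ι : Type*} [CommRing R] [IsDomain R] [DecidableEq ι]
    {s : Finset ι} (hs : s.Nonempty) {x : ι → R} (hx : ∀ i ∈ s, x i ≠ 0) {g : ι → ι → R}
    (hg : ∀ j ∈ s, ∀ i ∈ s, i ≠ j → g i j * (x j - x i) = x j) (n : ℕ) :
    PowerSeries.coeff n (∏ i ∈ s, (PowerSeries.mk fun n => x i ^ n) ^ 2) =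
      ∑ j ∈ s, (2 * (∏ i ∈ s.erase j, g i j ^ 2) * ∑ i ∈ s.erase j, (1 - g i j) +
        (n + 1) * ∏ i ∈ s.erase j, g i j ^ 2) * x j ^ n :=
  coeff_prod_mk_pow_sq_of_sum_eq_one (sum_doublePole_mul_prod hs hx hg) n

end PartialFractions

/-! ### The partial fraction coefficients as power series -/

section Coefficients

open PowerSeries

/-- The power series `1 / (1 - z^m)`. -/
noncomputable def geomSeries (m : ℕ) : ℂ⟦X⟧ :=
  mk fun n => if m ∣ n then 1 else 0

theorem geomSeries_mul {m : ℕ} (hm : 0 < m) : geomSeries m * (1 - X ^ m) = 1 := by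
  ext n
  rw [mul_sub, mul_one, map_sub, coeff_mul_X_pow', coeff_one, geomSeries, coeff_mk]
  by_cases h : m ≤ n
  · have hn : n ≠ 0 := by lia
    simp only [if_pos h, coeff_mk, Nat.dvd_sub_iff_left h (dvd_refl m), sub_self, if_neg hn]
  · have hiff : m ∣ n ↔ n = 0 :=
      ⟨fun hd => Nat.eq_zero_of_dvd_of_lt hd (not_le.1 h), fun hn => hn ▸ dvd_zero m⟩
    rw [if_neg h, sub_zero]
    simp only [hiff]

/-- The expansion of `1 / (1 - z^(2i) / z^(2j))` as a power series in `z`, for `i ≠ j`. For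
`i < j` it is `-z^(2(j-i)) / (1 - z^(2(j-i)))`. -/
noncomputable def ratioSeries (i j : ℕ) : ℂ⟦X⟧ :=
  if j < i then geomSeries (2 * (i - j)) else -(X ^ (2 * (j - i)) * geomSeries (2 * (j - i)))

theorem ratioSeries_mul {i j : ℕ} (hij : i ≠ j) :
    ratioSeries i j * (X ^ (2 * j) - X ^ (2 * i)) = X ^ (2 * j) := by
  rw [ratioSeries]
  split_ifs with h
  · have hg := geomSeries_mul (m := 2 * (i - j)) (by lia)
    have hi : 2 * i = 2 * j + 2 * (i - j) := by lia
    rw [hi, pow_add]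
    linear_combination X ^ (2 * j) * hg
  · have hg := geomSeries_mul (m := 2 * (j - i)) (by lia)
    have hj : 2 * j = 2 * i + 2 * (j - i) := by lia
    rw [hj, pow_add]
    linear_combination X ^ (2 * i) * X ^ (2 * (j - i)) * hg

/-- The coefficient `B_j` of `(1 - t z^(2j))⁻²` in the partial fraction expansion of
`f_{d,d}(t z^d, z)`. -/
noncomputable def doublePoleCoeff (d j : ℕ) : ℂ⟦X⟧ :=
  ∏ i ∈ (Finset.range (d + 1)).erase j, ratioSeries i j ^ 2

/-- The coefficient `A_j` of `(1 - t z^(2j))⁻¹` in the partial fraction expansion of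
`f_{d,d}(t z^d, z)`. -/
noncomputable def simplePoleCoeff (d j : ℕ) : ℂ⟦X⟧ :=
  2 * doublePoleCoeff d j * ∑ i ∈ (Finset.range (d + 1)).erase j, (1 - ratioSeries i j)

theorem constantCoeff_doublePoleCoeff {d j : ℕ} (hj : j ≠ 0) :
    constantCoeff (doublePoleCoeff d j) = 0 := by
  rw [doublePoleCoeff, map_prod]
  refine Finset.prod_eq_zero (i := 0) (by simp [hj.symm]) ?_
  simp [ratioSeries, hj]

theorem constantCoeff_simplePoleCoeff {d j : ℕ} (hj : j ≠ 0) :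
    constantCoeff (simplePoleCoeff d j) = 0 := by
  rw [simplePoleCoeff, map_mul, map_mul, constantCoeff_doublePoleCoeff hj, mul_zero, zero_mul]

/-- The number of the coordinate in its summand, counted from `0`. -/
def coordIndex (d : ℕ) : FormIdx d d → ℕ :=
  Sum.elim (fun i => i) (fun i => i)

/-- The `n`-th coefficient in `t` of `f_{d,d}(t z^d, z)`: each monomial of degree `n` contributes
`z` to the power `nd` minus its weight. -/
noncomputable def weightSeries (d n : ℕ) : ℂ⟦X⟧ :=
  ∑ l ∈ Finset.finsuppAntidiag (Finset.univ : Finset (FormIdx d d)) n,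
    X ^ ∑ i, 2 * coordIndex d i * l i

theorem weightSeries_eq (d n : ℕ) :
    weightSeries d n = ∑ j ∈ Finset.range (d + 1),
      (simplePoleCoeff d j + ((n : ℂ⟦X⟧) + 1) * doublePoleCoeff d j) * (X ^ (2 * j)) ^ n := by
  have h := coeff_prod_mk_pow_sq (R := ℂ⟦X⟧) (s := Finset.range (d + 1)) (by simp)
    (x := fun i => X ^ (2 * i)) (fun i _ => pow_ne_zero _ X_ne_zero) (g := ratioSeries)
    (fun j _ i _ hij => ratioSeries_mul hij) n
  refine Eq.trans ?_ h
  have hprod : ∏ i ∈ Finset.range (d + 1), (mk fun n => ((X : ℂ⟦X⟧) ^ (2 * i)) ^ n) ^ 2 =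
      ∏ i : FormIdx d d, mk fun n => ((X : ℂ⟦X⟧) ^ (2 * coordIndex d i)) ^ n := by
    rw [Fintype.prod_sum_type, Finset.prod_pow, sq]
    congr 1 <;> exact (Fin.prod_univ_eq_prod_range
      (fun i => mk fun n => ((X : ℂ⟦X⟧) ^ (2 * i)) ^ n) (d + 1)).symm
  rw [hprod, coeff_prod, weightSeries]
  refine Finset.sum_congr rfl fun l _ => ?_
  rw [← Finset.prod_pow_eq_pow_sum]
  exact Finset.prod_congr rfl fun i _ => by rw [coeff_mk, pow_mul]

theorem weight_formWeight (d n : ℕ) {l : FormIdx d d →₀ ℕ} (hl : l.degree = n) :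
    Finsupp.weight (formWeight d d) l = (n * d : ℕ) - (∑ i, 2 * coordIndex d i * l i : ℕ) := by
  have h1 (i : FormIdx d d) : formWeight d d i = (d : ℤ) - 2 * coordIndex d i := by
    rcases i with i | i <;> rfl
  rw [← hl, Finsupp.weight_apply, Finsupp.sum_fintype _ _ (by simp), Finsupp.degree_eq_sum,
    Finset.sum_mul]
  push_cast
  rw [← Finset.sum_sub_distrib]
  refine Finset.sum_congr rfl fun i _ => ?_
  rw [h1, nsmul_eq_mul]
  ring

/-- The coefficients of `weightSeries` are the multiplicities of the weights. -/
theorem coeff_X_pow_mul_weightSeries (d n μ : ℕ) :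
    coeff (n * d) (X ^ μ * weightSeries d n) =
      ((exponentSet (formWeight d d) n {(μ : ℤ)}).ncard : ℂ) := by
  classical
  have hset : exponentSet (formWeight d d) n {(μ : ℤ)} =
      ((Finset.finsuppAntidiag (Finset.univ : Finset (FormIdx d d)) n).filter
        fun l => n * d = μ + ∑ i, 2 * coordIndex d i * l i : Finset _) := by
    ext l
    rw [Finset.coe_filter, Set.mem_ofPred_eq, Finset.mem_finsuppAntidiag, exponentSet,
      Set.mem_ofPred_eq, Set.mem_singleton_iff, ← Finsupp.degree_eq_sum]
    simp only [Finset.subset_univ, and_true]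
    refine and_congr_right fun hl => ?_
    rw [weight_formWeight d n hl]
    lia
  rw [hset, Set.ncard_coe_finset, weightSeries, Finset.mul_sum, map_sum, Finset.card_filter]
  push_cast
  refine Finset.sum_congr rfl fun l _ => ?_
  rw [← pow_add, coeff_X_pow]

/-- The poles `z^(-2j)` with `2j > d` do not contribute to the coefficient of `z^(nd)`. -/
theorem coeff_mul_weightSeries (d n : ℕ) (Q : ℂ⟦X⟧) :
    coeff (n * d) (Q * weightSeries d n) = ∑ j ∈ Finset.range (d / 2 + 1),
      (coeff (n * (d - 2 * j)) (Q * simplePoleCoeff d j) +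
        (n + 1) * coeff (n * (d - 2 * j)) (Q * doublePoleCoeff d j)) := by
  rw [weightSeries_eq, Finset.mul_sum, map_sum]
  have hterm (j : ℕ) : Q * ((simplePoleCoeff d j + ((n : ℂ⟦X⟧) + 1) * doublePoleCoeff d j) *
      (X ^ (2 * j)) ^ n) = (Q * simplePoleCoeff d j + C ((n : ℂ) + 1) * (Q * doublePoleCoeff d j)) *
        X ^ (n * (2 * j)) := by
    rw [mul_comm n, pow_mul, map_add, map_natCast, map_one]
    ring
  refine (Finset.sum_subset_zero_on_sdiff (Finset.range_mono (by lia)) (fun j hj => ?_)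
    fun j hj => ?_).symm
  · rw [hterm, coeff_mul_X_pow']
    rw [Finset.mem_sdiff, Finset.mem_range, Finset.mem_range] at hj
    have hj0 : j ≠ 0 := by lia
    split_ifs with h
    · have hn : n = 0 := by
        by_contra hn
        have := Nat.le_of_mul_le_mul_left h (Nat.pos_of_ne_zero hn)
        lia
      subst hn
      simp [constantCoeff_doublePoleCoeff hj0, constantCoeff_simplePoleCoeff hj0]
    · rfl
  · rw [Finset.mem_range] at hj
    rw [hterm, coeff_mul_X_pow', if_pos (Nat.mul_le_mul_left n (by lia)), ← Nat.mul_sub, map_add,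
      coeff_C_mul]

theorem coeff_derivative_X_mul (F : ℂ⟦X⟧) (n : ℕ) :
    coeff n (derivative ℂ (X * F)) = (n + 1) * coeff n F := by
  rw [coeff_derivative, coeff_succ_X_mul, mul_comm]

theorem eq_sum_phi {d : ℕ} {F Q : ℂ⟦X⟧}
    (h : ∀ n, coeff n F = coeff (n * d) (Q * weightSeries d n)) :
    F = ∑ k ∈ Finset.range (d / 2 + 1), phi (d - 2 * k) (Q * simplePoleCoeff d k) +
      ∑ k ∈ Finset.range (d / 2 + 1),
        derivative ℂ (X * phi (d - 2 * k) (Q * doublePoleCoeff d k)) := by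
  ext n
  rw [h, coeff_mul_weightSeries, map_add, map_sum, map_sum, Finset.sum_add_distrib]
  congr 1
  · exact Finset.sum_congr rfl fun k _ => by rw [phi, coeff_mk]
  · exact Finset.sum_congr rfl fun k _ => by rw [coeff_derivative_X_mul, phi, coeff_mk]

theorem poincareInvariants_eq (d : ℕ) : poincareInvariants d d =
    ∑ k ∈ Finset.range (d / 2 + 1), phi (d - 2 * k) ((1 - X ^ 2) * simplePoleCoeff d k) +
      ∑ k ∈ Finset.range (d / 2 + 1),
        derivative ℂ (X * phi (d - 2 * k) ((1 - X ^ 2) * doublePoleCoeff d k)) := by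
  refine eq_sum_phi fun n => ?_
  have h0 := coeff_X_pow_mul_weightSeries d n 0
  have h2 := coeff_X_pow_mul_weightSeries d n 2
  have hdim := congrArg (Nat.cast : ℕ → ℂ) (finrank_invariantsOfDegree d d n)
  rw [pow_zero, one_mul] at h0
  rw [sub_mul, one_mul, map_sub, h0, h2, poincareInvariants, coeff_mk]
  push_cast at hdim ⊢
  exact eq_sub_of_add_eq hdim

theorem coeff_one_add_X_mul_weightSeries (d n : ℕ) :
    coeff (n * d) ((1 + X) * weightSeries d n) =
      ((exponentSet (formWeight d d) n {0}).ncard : ℂ) +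
        (exponentSet (formWeight d d) n {1}).ncard := by
  have h0 := coeff_X_pow_mul_weightSeries d n 0
  have h1 := coeff_X_pow_mul_weightSeries d n 1
  rw [pow_zero, one_mul] at h0
  rw [pow_one] at h1
  rw [add_mul, one_mul, map_add, h0, h1]
  simp

theorem poincareSemiInvariants_eq (d : ℕ) : poincareSemiInvariants d d =
    ∑ k ∈ Finset.range (d / 2 + 1), phi (d - 2 * k) ((1 + X) * simplePoleCoeff d k) +
      ∑ k ∈ Finset.range (d / 2 + 1),
        derivative ℂ (X * phi (d - 2 * k) ((1 + X) * doublePoleCoeff d k)) := by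
  refine eq_sum_phi fun n => ?_
  rw [coeff_one_add_X_mul_weightSeries, poincareSemiInvariants, coeff_mk,
    finrank_semiInvariantsOfDegree, Nat.cast_add]

theorem poincareCovariants_eq (d : ℕ) : poincareCovariants d d =
    ∑ k ∈ Finset.range (d / 2 + 1), phi (d - 2 * k) ((1 + X) * simplePoleCoeff d k) +
      ∑ k ∈ Finset.range (d / 2 + 1),
        derivative ℂ (X * phi (d - 2 * k) ((1 + X) * doublePoleCoeff d k)) := by
  refine eq_sum_phi fun n => ?_
  rw [coeff_one_add_X_mul_weightSeries, poincareCovariants, coeff_mk,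
    finrank_covariantsOfDegree, Nat.cast_add]

end Coefficients

/-! ### Expansions in the punctured disc -/

section Expansions

open PowerSeries

/-- The power series `F` converges absolutely at `z`, with sum `v`. -/
def EvaluatesTo (z : ℂ) (F : ℂ⟦X⟧) (v : ℂ) : Prop :=
  (Summable fun n => ‖coeff n F * z ^ n‖) ∧ HasSum (fun n => coeff n F * z ^ n) v

namespace EvaluatesTo

variable {z v w : ℂ} {F G : ℂ⟦X⟧}

theorem of_summable (h : Summable fun n => ‖coeff n F * z ^ n‖) :
    EvaluatesTo z F (∑' n, coeff n F * z ^ n) :=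
  ⟨h, h.of_norm.hasSum⟩

theorem unique (hF : EvaluatesTo z F v) (hF' : EvaluatesTo z F w) : v = w :=
  hF.2.unique hF'.2

theorem monomial (c : ℂ) (m : ℕ) : EvaluatesTo z (C c * X ^ m) (c * z ^ m) := by
  have h (n : ℕ) (hn : n ≠ m) : coeff n (C c * X ^ m) * z ^ n = 0 := by
    simp [coeff_X_pow, hn]
  refine ⟨summable_of_ne_finset_zero (s := {m}) fun n hn => ?_, ?_⟩
  · rw [h n (by simpa using hn), norm_zero]
  · convert hasSum_single m h using 1
    simp [coeff_X_pow]

theorem X_pow (m : ℕ) : EvaluatesTo z (X ^ m) (z ^ m) := by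
  simpa using monomial (z := z) 1 m

theorem const (c : ℂ) : EvaluatesTo z (C c) c := by
  simpa using monomial (z := z) c 0

theorem one : EvaluatesTo z 1 1 := by
  simpa using X_pow (z := z) 0

theorem add (hF : EvaluatesTo z F v) (hG : EvaluatesTo z G w) :
    EvaluatesTo z (F + G) (v + w) := by
  simp only [EvaluatesTo, map_add, add_mul]
  exact ⟨(hF.1.add hG.1).of_nonneg_of_le (fun _ => norm_nonneg _) fun _ => norm_add_le _ _,
    hF.2.add hG.2⟩

theorem mul (hF : EvaluatesTo z F v) (hG : EvaluatesTo z G w) :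
    EvaluatesTo z (F * G) (v * w) := by
  have h (n : ℕ) : coeff n (F * G) * z ^ n = ∑ p ∈ Finset.HasAntidiagonal.antidiagonal n,
      (coeff p.1 F * z ^ p.1) * (coeff p.2 G * z ^ p.2) := by
    rw [coeff_mul, Finset.sum_mul]
    refine Finset.sum_congr rfl fun p hp => ?_
    rw [← Finset.HasAntidiagonal.mem_antidiagonal.1 hp, pow_add]
    ring
  have hs : Summable fun n => ‖coeff n (F * G) * z ^ n‖ :=
    (summable_norm_sum_mul_antidiagonal_of_summable_norm (f := fun n => coeff n F * z ^ n)
      (g := fun n => coeff n G * z ^ n) hF.1 hG.1).congr fun n => by rw [h]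
  refine ⟨hs, ?_⟩
  have ht := tsum_mul_tsum_eq_tsum_sum_antidiagonal_of_summable_norm
    (f := fun n => coeff n F * z ^ n) (g := fun n => coeff n G * z ^ n) hF.1 hG.1
  rw [hF.2.tsum_eq, hG.2.tsum_eq] at ht
  rw [ht, ← tsum_congr h]
  exact hs.of_norm.hasSum

theorem neg (hF : EvaluatesTo z F v) : EvaluatesTo z (-F) (-v) := by
  simpa using (const (z := z) (-1)).mul hF

theorem sub (hF : EvaluatesTo z F v) (hG : EvaluatesTo z G w) :
    EvaluatesTo z (F - G) (v - w) := by
  simpa [sub_eq_add_neg] using hF.add hG.neg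

theorem pow (hF : EvaluatesTo z F v) (n : ℕ) : EvaluatesTo z (F ^ n) (v ^ n) := by
  induction n with
  | zero => simpa using one
  | succ n ih => simpa [pow_succ] using ih.mul hF

variable {ι : Type*} {s : Finset ι} {f : ι → ℂ⟦X⟧} {a : ι → ℂ}

theorem sum (h : ∀ i ∈ s, EvaluatesTo z (f i) (a i)) :
    EvaluatesTo z (∑ i ∈ s, f i) (∑ i ∈ s, a i) := by
  classical
  induction s using Finset.induction_on with
  | empty => simpa using const (z := z) 0
  | insert i s hi ih =>
    rw [Finset.sum_insert hi, Finset.sum_insert hi]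
    exact (h i (by simp)).add (ih fun j hj => h j (Finset.mem_insert_of_mem hj))

theorem prod (h : ∀ i ∈ s, EvaluatesTo z (f i) (a i)) :
    EvaluatesTo z (∏ i ∈ s, f i) (∏ i ∈ s, a i) := by
  classical
  induction s using Finset.induction_on with
  | empty => simpa using one
  | insert i s hi ih =>
    rw [Finset.prod_insert hi, Finset.prod_insert hi]
    exact (h i (by simp)).mul (ih fun j hj => h j (Finset.mem_insert_of_mem hj))

end EvaluatesTo

theorem pow_two_mul_sub_ne_zero {z : ℂ} (h0 : 0 < ‖z‖) (h1 : ‖z‖ < 1) {i j : ℕ} (hij : i ≠ j) :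
    z ^ (2 * j) - z ^ (2 * i) ≠ 0 := by
  intro h
  have h2 := congrArg norm (sub_eq_zero.1 h)
  rw [norm_pow, norm_pow] at h2
  have := pow_right_injective₀ h0 h1.ne h2
  lia

theorem evaluatesTo_ratioSeries {z : ℂ} (h0 : 0 < ‖z‖) (h1 : ‖z‖ < 1) {i j : ℕ} (hij : i ≠ j) :
    EvaluatesTo z (ratioSeries i j) (z ^ (2 * j) / (z ^ (2 * j) - z ^ (2 * i))) := by
  have hgeom (m : ℕ) : ∃ v, EvaluatesTo z (geomSeries m) v := by
    refine ⟨_, EvaluatesTo.of_summable ((summable_geometric_of_lt_one h0.le h1).of_nonneg_of_le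
      (fun _ => norm_nonneg _) fun n => ?_)⟩
    rw [geomSeries, coeff_mk]
    split_ifs <;> simp
  have hex : ∃ v, EvaluatesTo z (ratioSeries i j) v := by
    rw [ratioSeries]
    split_ifs
    · exact hgeom _
    · obtain ⟨v, hv⟩ := hgeom (2 * (j - i))
      exact ⟨_, ((EvaluatesTo.X_pow _).mul hv).neg⟩
  obtain ⟨v, hv⟩ := hex
  have hmul := hv.mul ((EvaluatesTo.X_pow (2 * j)).sub (EvaluatesTo.X_pow (2 * i)))
  rw [ratioSeries_mul hij] at hmul
  rwa [← eq_div_of_mul_eq (pow_two_mul_sub_ne_zero h0 h1 hij)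
    (hmul.unique (EvaluatesTo.X_pow _))]

/-- The product `∏_{i ≠ k} (1 - t z^(2i))⁻²`, which extends `poleCleared d k z` over the removable
singularity `t = z^(-2k)`. -/
noncomputable def regularPart (d k : ℕ) (z t : ℂ) : ℂ :=
  ∏ i ∈ (Finset.range (d + 1)).erase k, ((1 - t * z ^ (2 * i))⁻¹) ^ 2

theorem poleCleared_eq_regularPart {d k : ℕ} (hk : k ≤ d) {z : ℂ} (hz : z ≠ 0) {t : ℂ}
    (ht : t ≠ 1 / z ^ (2 * k)) : poleCleared d k z t = regularPart d k z t := by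
  have hprod : ∏ i ∈ Finset.range (d + 1), (1 - t * z ^ d * z ^ ((d : ℤ) - 2 * (i : ℤ))) =
      ∏ i ∈ Finset.range (d + 1), (1 - t * z ^ (2 * i)) := by
    rw [← Finset.prod_range_reflect]
    refine Finset.prod_congr rfl fun i hi => ?_
    have hid := Finset.mem_range.1 hi
    rw [mul_assoc, ← zpow_natCast z d, ← zpow_add₀ hz, ← zpow_natCast z (2 * i)]
    congr 3
    push_cast [Nat.cast_sub (Nat.lt_succ_iff.1 hid)]
    lia
  have hne : 1 - t * z ^ (2 * k) ≠ 0 := by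
    intro h
    exact ht (eq_one_div_of_mul_eq_one_left (sub_eq_zero.1 h).symm)
  rw [poleCleared, genFun, hprod,
    ← Finset.mul_prod_erase _ _ (Finset.mem_range.2 (by lia : k < d + 1)),
    regularPart, Finset.prod_pow, Finset.prod_inv_distrib]
  set P := ∏ i ∈ (Finset.range (d + 1)).erase k, (1 - t * z ^ (2 * i))
  rw [one_div, mul_inv, mul_inv]
  field_simp

section

variable {d k : ℕ} {z : ℂ}

theorem eventually_poleCleared_eq (hk : k ≤ d) (hz : z ≠ 0) :
    ∀ᶠ t in 𝓝[≠] (1 / z ^ (2 * k)), poleCleared d k z t = regularPart d k z t :=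
  Filter.eventually_of_mem self_mem_nhdsWithin fun _ ht => poleCleared_eq_regularPart hk hz ht

theorem inv_one_sub_pole_mul (h0 : 0 < ‖z‖) (h1 : ‖z‖ < 1) {i : ℕ} (hi : i ≠ k) :
    (1 - 1 / z ^ (2 * k) * z ^ (2 * i))⁻¹ = z ^ (2 * k) / (z ^ (2 * k) - z ^ (2 * i)) := by
  have hz : z ≠ 0 := norm_pos_iff.1 h0
  have := pow_two_mul_sub_ne_zero h0 h1 hi
  rw [← inv_div]
  field_simp

theorem one_sub_pole_mul_ne_zero (h0 : 0 < ‖z‖) (h1 : ‖z‖ < 1) {i : ℕ} (hi : i ≠ k) :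
    1 - 1 / z ^ (2 * k) * z ^ (2 * i) ≠ 0 := by
  have hz : z ≠ 0 := norm_pos_iff.1 h0
  refine fun h => ?_
  have h' := inv_one_sub_pole_mul h0 h1 hi
  rw [h, inv_zero, eq_comm] at h'
  revert h'
  exact div_ne_zero (pow_ne_zero _ hz) (pow_two_mul_sub_ne_zero h0 h1 hi)

theorem analyticAt_regularPart (h0 : 0 < ‖z‖) (h1 : ‖z‖ < 1) :
    AnalyticAt ℂ (regularPart d k z) (1 / z ^ (2 * k)) := by
  unfold regularPart
  refine Finset.analyticAt_fun_prod _ fun i hi => ?_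
  refine AnalyticAt.pow (AnalyticAt.inv (by fun_prop) ?_) 2
  exact one_sub_pole_mul_ne_zero h0 h1 (Finset.ne_of_mem_erase hi)

theorem evaluatesTo_doublePoleCoeff (h0 : 0 < ‖z‖) (h1 : ‖z‖ < 1) :
    EvaluatesTo z (doublePoleCoeff d k) (regularPart d k z (1 / z ^ (2 * k))) := by
  refine EvaluatesTo.prod fun i hi => ?_
  rw [inv_one_sub_pole_mul h0 h1 (Finset.ne_of_mem_erase hi)]
  exact (evaluatesTo_ratioSeries h0 h1 (Finset.ne_of_mem_erase hi)).pow 2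

theorem deriv_regularPart (h0 : 0 < ‖z‖) (h1 : ‖z‖ < 1) :
    deriv (regularPart d k z) (1 / z ^ (2 * k)) = regularPart d k z (1 / z ^ (2 * k)) *
      ∑ i ∈ (Finset.range (d + 1)).erase k,
        2 * (z ^ (2 * i) * (z ^ (2 * k) / (z ^ (2 * k) - z ^ (2 * i)))) := by
  have hR : regularPart d k z (1 / z ^ (2 * k)) ≠ 0 :=
    Finset.prod_ne_zero_iff.2 fun i hi =>
      pow_ne_zero 2 (inv_ne_zero (one_sub_pole_mul_ne_zero h0 h1 (Finset.ne_of_mem_erase hi)))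
  have hfac (i : ℕ) (hi : i ≠ k) : HasDerivAt (fun t : ℂ => ((1 - t * z ^ (2 * i))⁻¹) ^ 2)
      (2 * (1 - 1 / z ^ (2 * k) * z ^ (2 * i))⁻¹ * (z ^ (2 * i) /
        (1 - 1 / z ^ (2 * k) * z ^ (2 * i)) ^ 2)) (1 / z ^ (2 * k)) := by
    have h := (((hasDerivAt_id (1 / z ^ (2 * k))).mul_const (z ^ (2 * i))).const_sub 1).fun_inv
      (one_sub_pole_mul_ne_zero h0 h1 hi)
    simpa using h.fun_pow 2
  have hlog : logDeriv (regularPart d k z) (1 / z ^ (2 * k)) =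
      ∑ i ∈ (Finset.range (d + 1)).erase k,
        2 * (z ^ (2 * i) * (z ^ (2 * k) / (z ^ (2 * k) - z ^ (2 * i)))) := by
    have h := logDeriv_prod (s := (Finset.range (d + 1)).erase k)
      (f := fun i (t : ℂ) => ((1 - t * z ^ (2 * i))⁻¹) ^ 2) (x := 1 / z ^ (2 * k))
      (fun i hi => pow_ne_zero 2 (inv_ne_zero
        (one_sub_pole_mul_ne_zero h0 h1 (Finset.ne_of_mem_erase hi))))
      (fun i hi => (hfac i (Finset.ne_of_mem_erase hi)).differentiableAt)
    refine h.trans (Finset.sum_congr rfl fun i hi => ?_)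
    have hne := one_sub_pole_mul_ne_zero h0 h1 (Finset.ne_of_mem_erase hi)
    rw [logDeriv_apply, (hfac i (Finset.ne_of_mem_erase hi)).deriv,
      ← inv_one_sub_pole_mul h0 h1 (Finset.ne_of_mem_erase hi)]
    generalize 1 - 1 / z ^ (2 * k) * z ^ (2 * i) = u at hne
    field_simp
  rw [← hlog, logDeriv_apply, mul_div_cancel₀ _ hR]

end

theorem isExpansionB_doublePoleCoeff {d k : ℕ} (hk : k ≤ d) :
    IsExpansionB d k (doublePoleCoeff d k) := by
  intro z h0 h1
  have hz : z ≠ 0 := norm_pos_iff.1 h0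
  refine ⟨_, ?_, (evaluatesTo_doublePoleCoeff h0 h1).2⟩
  exact ((analyticAt_regularPart h0 h1).continuousAt.tendsto.mono_left nhdsWithin_le_nhds).congr'
    ((eventually_poleCleared_eq hk hz).mono fun _ h => h.symm)

theorem isExpansionA_simplePoleCoeff {d k : ℕ} (hk : k ≤ d) :
    IsExpansionA d k (simplePoleCoeff d k) := by
  intro z h0 h1
  have hz : z ≠ 0 := norm_pos_iff.1 h0
  refine ⟨deriv (regularPart d k z) (1 / z ^ (2 * k)), ?_, ?_⟩
  · refine ((analyticAt_regularPart h0 h1).deriv.continuousAt.tendsto.mono_left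
      nhdsWithin_le_nhds).congr' ?_
    refine Filter.eventually_of_mem self_mem_nhdsWithin fun t ht => ?_
    refine Filter.EventuallyEq.deriv_eq ?_
    filter_upwards [isOpen_compl_singleton.mem_nhds ht] with s hs
    exact (poleCleared_eq_regularPart hk hz hs).symm
  · have hA : EvaluatesTo z (simplePoleCoeff d k) (2 * regularPart d k z (1 / z ^ (2 * k)) *
        ∑ i ∈ (Finset.range (d + 1)).erase k,
          (1 - z ^ (2 * k) / (z ^ (2 * k) - z ^ (2 * i)))) := by
      have h2 : EvaluatesTo z 2 2 := by
        rw [← map_ofNat (C : ℂ →+* ℂ⟦X⟧) 2]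
        exact EvaluatesTo.const 2
      exact (h2.mul (evaluatesTo_doublePoleCoeff h0 h1)).mul (EvaluatesTo.sum fun i hi =>
        EvaluatesTo.one.sub (evaluatesTo_ratioSeries h0 h1 (Finset.ne_of_mem_erase hi)))
    convert hA.2 using 1
    have hsum : 1 / z ^ (2 * k) * ∑ i ∈ (Finset.range (d + 1)).erase k,
        2 * (z ^ (2 * i) * (z ^ (2 * k) / (z ^ (2 * k) - z ^ (2 * i)))) =
        -(2 * ∑ i ∈ (Finset.range (d + 1)).erase k,
          (1 - z ^ (2 * k) / (z ^ (2 * k) - z ^ (2 * i)))) := by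
      rw [Finset.mul_sum, Finset.mul_sum, ← Finset.sum_neg_distrib]
      refine Finset.sum_congr rfl fun i hi => ?_
      have hne := pow_two_mul_sub_ne_zero h0 h1 (Finset.ne_of_mem_erase hi)
      have hzk : z ^ (2 * k) ≠ 0 := pow_ne_zero _ hz
      field_simp
      ring
    rw [deriv_regularPart h0 h1]
    linear_combination -regularPart d k z (1 / z ^ (2 * k)) * hsum

end Expansions

theorem theorem5 (d : ℕ) :
    (∀ n : ℕ, FiniteDimensional ℂ (invariantsOfDegree d d n) ∧
      FiniteDimensional ℂ (semiInvariantsOfDegree d d n) ∧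
      FiniteDimensional ℂ (covariantsOfDegree d d n)) ∧
    ∃ A B : ℕ → ℂ⟦X⟧,
      (∀ k : ℕ, 2 * k ≤ d → IsExpansionA d k (A k) ∧ IsExpansionB d k (B k)) ∧
      poincareInvariants d d =
        ∑ k ∈ Finset.range (d / 2 + 1), phi (d - 2 * k) ((1 - PowerSeries.X ^ 2) * A k) +
        ∑ k ∈ Finset.range (d / 2 + 1), PowerSeries.derivative ℂ
          (PowerSeries.X * phi (d - 2 * k) ((1 - PowerSeries.X ^ 2) * B k)) ∧
      poincareSemiInvariants d d =
        ∑ k ∈ Finset.range (d / 2 + 1), phi (d - 2 * k) ((1 + PowerSeries.X) * A k) +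
        ∑ k ∈ Finset.range (d / 2 + 1), PowerSeries.derivative ℂ
          (PowerSeries.X * phi (d - 2 * k) ((1 + PowerSeries.X) * B k)) ∧
      poincareCovariants d d =
        ∑ k ∈ Finset.range (d / 2 + 1), phi (d - 2 * k) ((1 + PowerSeries.X) * A k) +
        ∑ k ∈ Finset.range (d / 2 + 1), PowerSeries.derivative ℂ
          (PowerSeries.X * phi (d - 2 * k) ((1 + PowerSeries.X) * B k)) :=
  ⟨fun n => ⟨finiteDimensional_invariantsOfDegree d d n,
    finiteDimensional_semiInvariantsOfDegree d d n, finiteDimensional_covariantsOfDegree d d n⟩,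
    simplePoleCoeff d, doublePoleCoeff d,
    fun _ hk => ⟨isExpansionA_simplePoleCoeff (by lia), isExpansionB_doublePoleCoeff (by lia)⟩,
    poincareInvariants_eq d, poincareSemiInvariants_eq d, poincareCovariants_eq d⟩
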